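/- Let $m=(m_0,m_1,\dots)$ be a bounded sequence of integers $m_k\ge 2$, let $G_m=\prod_k \mathbb Z/m_k\mathbb Z$ be the corresponding (bounded) Vilenkin group with its normalized Haar measure $\mu$ (the product of the uniform measures). Put $M_0=1$, $M_{k+1}=m_kM_k$, and for $n=\sum_k n_kM_k$ with $0\le n_k<m_k$ let $\psi_n(x)=\prod_k \exp(2\pi i\,x_k/m_k)^{n_k}$ be the Vilenkin functions. Let $\mathcal F_n$ be the $\sigma$-algebra generated by the first $n$ coordinates. For $0<p<\infty$ the martingale Hardy space $H_p$ consists of the complex-valued martingales $f=(f^{(n)})_{n\ge0}$ with respect to $(\mathcal F_n)$ with $\|f\|_{H_p}:=\big\|\sup_n|f^{(n)}|\big\|_p<\infty$, and $\|g\|_{weak\text{-}L_p}:=\sup_{\lambda>0}\lambda\,\mu(|g|>\lambda)^{1/p}$. For a martingale $f$ put $$\widehat f(i)=\lim_{k\to\infty}\int_{G_m}f^{(k)}\overline{\psi_i}\,d\mu,\qquad S_nf=\sum_{k=0}^{n-1}\widehat f(k)\psi_k .$$ Let $(q_k)_{k\ge0}$ be a non-increasing sequence of non-negative real numbers with $q_0>0$,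 and put $$Q_n=\sum_{k=0}^{n-1}q_k,\qquad T_nf=\frac1{Q_n}\sum_{k=0}^{n-1}q_kS_kf\quad(n\ge1),\qquad T_0f=0,\qquad T^*f=\sup_{n}|T_nf| .$$ a) The maximal operator $T^*$ is bounded from $H_{1/2}$ to $weak\text{-}L_{1/2}$: there is a constant $C<\infty$ such that for every $f\in H_{1/2}$ the function $T^*f$ is measurable and $\|T^*f\|_{weak\text{-}L_{1/2}}\le C\,\|f\|_{H_{1/2}}$. b) The exponent $1/2$ in a) is sharp in the following sense. Let $0<p<1/2$ and suppose that there is a constant $c>0$ with $$\frac{q_{n+1}}{Q_{n+2}}\ge\frac cn\qquad\text{for all } n\ge1 .$$ Then there is a martingale $f\in H_p$ such that $$\sup_{n\in\mathbb N}\|T_nf\|_{weak\text{-}L_p}=\infty .$$ -/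

import Mathlib

open MeasureTheory ProbabilityTheory Filter Topology
open scoped ENNReal NNReal

/-! ### Vilenkin groups -/

/-- The Vilenkin group `G_m`, the complete direct product of the cyclic groups `ℤ/m_kℤ`.
Each factor carries the discrete topology and the discrete `σ`-algebra. -/
abbrev VilenkinGroup (m : ℕ → ℕ) : Type := ∀ k, ZMod (m k)

namespace Vilenkin

noncomputable section

/-- The uniform measure `μ_k(j) = 1 / m_k` on `ℤ/m_kℤ`. -/
def factorMeasure (m : ℕ → ℕ) (k : ℕ) : Measure (ZMod (m k)) :=
  ((m k : ℝ≥0∞)⁻¹) • Measure.count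

/-- The normalized Haar measure on `G_m`: the product of the uniform measures on the factors. -/
def haar (m : ℕ → ℕ) : Measure (VilenkinGroup m) :=
  Measure.infinitePi (factorMeasure m)

instance (m : ℕ → ℕ) [∀ k, NeZero (m k)] (k : ℕ) : IsProbabilityMeasure (factorMeasure m k) := by
  constructor
  have h : (m k : ℝ≥0∞) ≠ 0 := by exact_mod_cast NeZero.ne (m k)
  rw [factorMeasure, Measure.smul_apply, Measure.count_univ, ENat.card_eq_coe_fintype_card,
    ZMod.card]
  simp [ENNReal.inv_mul_cancel h (ENNReal.natCast_ne_top _)]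

instance (m : ℕ → ℕ) [∀ k, NeZero (m k)] : IsProbabilityMeasure (haar m) := by
  unfold haar
  infer_instance

/-- The interval `I_n(x)` of all `y` that agree with `x` in the coordinates `0, …, n - 1`. -/
def interval (m : ℕ → ℕ) (n : ℕ) (x : VilenkinGroup m) : Set (VilenkinGroup m) :=
  {y | ∀ i < n, y i = x i}

/-- The filtration whose `n`-th `σ`-algebra is generated by the first `n` coordinates.
It is the `σ`-algebra generated by the intervals `I_n(x)`, see `filtration_eq_generateFrom`. -/
def filtration (m : ℕ → ℕ) :
    Filtration ℕ (inferInstance : MeasurableSpace (VilenkinGroup m)) where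
  seq n := MeasurableSpace.comap (fun (x : VilenkinGroup m) (i : Fin n) => x i) inferInstance
  mono' := by
    intro a b hab
    have h : (fun (x : VilenkinGroup m) (i : Fin a) => x i) =
        (fun (y : ∀ i : Fin b, ZMod (m i)) (i : Fin a) => y (Fin.castLE hab i)) ∘
          (fun (x : VilenkinGroup m) (i : Fin b) => x i) := rfl
    simp only
    rw [h, ← MeasurableSpace.comap_comp]
    refine MeasurableSpace.comap_mono (Measurable.comap_le ?_)
    exact measurable_pi_lambda _ fun i => measurable_pi_apply (Fin.castLE hab i)
  le' := by
    intro n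
    exact Measurable.comap_le (measurable_pi_lambda _ fun i => measurable_pi_apply _)

theorem filtration_eq_generateFrom (m : ℕ → ℕ) [∀ k, NeZero (m k)] (n : ℕ) :
    filtration m n =
      MeasurableSpace.generateFrom {s | ∃ x : VilenkinGroup m, s = interval m n x} := by
  have key : ∀ x : VilenkinGroup m, interval m n x =
      (fun (x : VilenkinGroup m) (i : Fin n) => x i) ⁻¹' {fun i : Fin n => x i} := by
    intro x
    ext y
    simp only [interval, Set.mem_ofPred_eq, Set.mem_preimage, Set.mem_singleton_iff]
    constructor
    · intro h
      funext i
      exact h i i.2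
    · intro h i hi
      exact congrFun h ⟨i, hi⟩
  apply le_antisymm
  · rintro s ⟨t, -, rfl⟩
    have ht : (fun (x : VilenkinGroup m) (i : Fin n) => x i) ⁻¹' t =
        ⋃ z ∈ t, (fun (x : VilenkinGroup m) (i : Fin n) => x i) ⁻¹' {z} := by
      ext y
      simp
    rw [ht]
    refine MeasurableSet.biUnion (Set.to_countable t) fun z _ => ?_
    refine MeasurableSpace.measurableSet_generateFrom
      ⟨fun k => if h : k < n then z ⟨k, h⟩ else 0, ?_⟩
    rw [key]
    congr 2
    funext i
    simp
  · refine MeasurableSpace.generateFrom_le ?_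
    rintro s ⟨x, rfl⟩
    rw [key]
    exact ⟨_, MeasurableSet.singleton _, rfl⟩

/-! ### The Vilenkin system -/

/-- The generalized number system `M_0 = 1`, `M_{k+1} = m_k M_k`. -/
def bigM (m : ℕ → ℕ) : ℕ → ℕ
  | 0 => 1
  | k + 1 => m k * bigM m k

/-- The digit `n_k` in the expansion `n = ∑ n_k M_k` with `0 ≤ n_k < m_k`. -/
def digit (m : ℕ → ℕ) (k n : ℕ) : ℕ := n / bigM m k % m k

theorem lt_bigM (m : ℕ → ℕ) (hm : ∀ k, 2 ≤ m k) (k : ℕ) : k < bigM m k := by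
  induction k with
  | zero => simp [bigM]
  | succ k ih =>
    have h : 2 * bigM m k ≤ m k * bigM m k := Nat.mul_le_mul_right _ (hm k)
    simp only [bigM]
    omega

theorem digit_eq_zero (m : ℕ → ℕ) (hm : ∀ k, 2 ≤ m k) {k n : ℕ} (h : n ≤ k) :
    digit m k n = 0 := by
  simp [digit, Nat.div_eq_of_lt (lt_of_le_of_lt h (lt_bigM m hm k))]

theorem sum_digit_mul_bigM (m : ℕ → ℕ) (hm : ∀ k, 2 ≤ m k) (n : ℕ) :
    ∑ k ∈ Finset.range n, digit m k n * bigM m k = n := by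
  have key : ∀ N, ∑ k ∈ Finset.range N, digit m k n * bigM m k = n % bigM m N := by
    intro N
    induction N with
    | zero => simp [bigM, Nat.mod_one]
    | succ N ih =>
      rw [Finset.sum_range_succ, ih, bigM, digit, mul_comm (m N), Nat.mod_mul]
      ring
  rw [key, Nat.mod_eq_of_lt (lt_bigM m hm n)]

/-- The generalized Rademacher function `r_k(x) = exp(2πi x_k / m_k)`. -/
def rademacher (m : ℕ → ℕ) (k : ℕ) (x : VilenkinGroup m) : ℂ :=
  Complex.exp (2 * Real.pi * Complex.I * ((x k).val : ℂ) / (m k : ℂ))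

/-- The Vilenkin function `ψ_n = ∏_k r_k ^ n_k`. All digits `n_k` with `k ≥ n` vanish
(`digit_eq_zero`), so the infinite product is the finite product over `k < n`. -/
def psi (m : ℕ → ℕ) (n : ℕ) (x : VilenkinGroup m) : ℂ :=
  ∏ k ∈ Finset.range n, rademacher m k x ^ digit m k n

/-! ### Weak Lebesgue spaces and martingale Hardy spaces -/

/-- The weak-`L_p` quasi-norm `sup_{t > 0} t · μ(|g| > t)^{1/p}`, with values in `[0, ∞]`. -/
def weakNorm {Ω E : Type*} [MeasurableSpace Ω] [ENorm E] (μ : Measure Ω) (p : ℝ)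
    (g : Ω → E) : ℝ≥0∞ :=
  ⨆ (t : ℝ≥0) (_ : 0 < t), (t : ℝ≥0∞) * μ {x | (t : ℝ≥0∞) < ‖g x‖ₑ} ^ (1 / p)

/-- The maximal function `f^* = sup_n |f^{(n)}|` of a sequence of functions. -/
def maximalFunction (m : ℕ → ℕ) (f : ℕ → VilenkinGroup m → ℂ) (x : VilenkinGroup m) : ℝ≥0∞ :=
  ⨆ n, ‖f n x‖ₑ

/-- The Hardy quasi-norm `‖f‖_{H_p} = ‖f^*‖_p`. -/
def hardyNorm (m : ℕ → ℕ) (p : ℝ) (f : ℕ → VilenkinGroup m → ℂ) : ℝ≥0∞ :=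
  eLpNorm (maximalFunction m f) (ENNReal.ofReal p) (haar m)

/-- `f ∈ H_p`: the sequence `f` is a martingale with `‖f‖_{H_p} < ∞`. -/
def MemHardy (m : ℕ → ℕ) (p : ℝ) (f : ℕ → VilenkinGroup m → ℂ) : Prop :=
  Martingale f (filtration m) (haar m) ∧ hardyNorm m p f < ∞

/-! ### Vilenkin-Fourier series and `T` means of martingales -/

/-- The Vilenkin-Fourier coefficient `lim_k ∫ f^{(k)} conj ψ_i` of a martingale; the sequence of
integrals is constant for `i < M_k`. -/
def fourierCoeff (m : ℕ → ℕ) (f : ℕ → VilenkinGroup m → ℂ) (i : ℕ) : ℂ :=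
  limUnder atTop fun k : ℕ => ∫ x, f k x * (starRingEnd ℂ) (psi m i x) ∂(haar m)

/-- The partial sum `S_n f = ∑_{k < n} f̂(k) ψ_k`. -/
def partialSum (m : ℕ → ℕ) (f : ℕ → VilenkinGroup m → ℂ) (n : ℕ) (x : VilenkinGroup m) : ℂ :=
  ∑ k ∈ Finset.range n, fourierCoeff m f k * psi m k x

/-- `Q_n = ∑_{k < n} q_k`. -/
def bigQ (q : ℕ → ℝ) (n : ℕ) : ℝ := ∑ k ∈ Finset.range n, q k

/-- The `T` mean `T_n f = Q_n⁻¹ ∑_{k < n} q_k S_k f`; for `n = 0` this is `0`. -/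
def tMean (m : ℕ → ℕ) (q : ℕ → ℝ) (f : ℕ → VilenkinGroup m → ℂ) (n : ℕ)
    (x : VilenkinGroup m) : ℂ :=
  ((bigQ q n : ℝ) : ℂ)⁻¹ * ∑ k ∈ Finset.range n, (q k : ℂ) * partialSum m f k x

/-- The maximal operator `T^* f = sup_n |T_n f|`. -/
def tMaximal (m : ℕ → ℕ) (q : ℕ → ℝ) (f : ℕ → VilenkinGroup m → ℂ) (x : VilenkinGroup m) :
    ℝ≥0∞ :=
  ⨆ n, ‖tMean m q f n x‖ₑ

end

end Vilenkin

/-! For a), Abel summation turns a bound `|∑_{k<j} S_k f| ≤ j Z` for all `j` into `|T_n f| ≤ Z`,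
because the weights are non-increasing (`norm_sum_mul_le`, `enorm_mean_le`). It therefore suffices
to control Fejér sums, with constants that depend only on `b = sup m_k`.

The unnormalized Fejér kernel is dominated by a sum of explicit multiples of indicators of boxes
(`enorm_fejer_le`). Two facts follow. Fejér means of a function bounded by `A` are `O(A)`
(`enorm_integral_mul_fejer_le`). Fejér means of a mean-zero function bounded by `A` and supported on
an interval of rank `n` are, off that interval, `O(A M_n⁻²)` times `tail`, a function in
weak-`L_{1/2}` uniformly in `n` and in the interval (`enorm_integral_atom_mul_fejer_le`,
`exists_tail_exceptional`).

Given `t`, take a level `l` comparable to `t` and stop `f` just before it exceeds `4^k l`, for each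
`k`. Differences of consecutive stopped martingales split into atoms bounded by `5 · 4^k l` on
disjoint intervals, so `f^{(N)}` is a function bounded by `l` plus atoms. The square roots of the
atoms' coefficients add up to a multiple of `∫ (f^*)^{1/2}` (`tsum_coeff_rpow_le`), and a series of
uniformly weak-`L_{1/2}` functions with such coefficients is again in weak-`L_{1/2}`
(`measure_le_tsum_le`). The supports of the atoms are covered by the weak-type bound for `f^*`.

For b), take `f = ∑_k w_k r_{a_k} 1_{I_{a_k}(0)}` with `w_k = (2^{-k} M_{a_k})^{1/p}`. The `p`-th
powers of the blocks integrate to `2^{-k}`, so `f ∈ H_p`. With `M = M_{a_K}`, the mean `T_{M+2} f`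
contains the new block only through the single term `q_{M+1} S_{M+1}`, which has constant modulus at
least `c w_K M⁻²`, comparable to `M^{1/p-2}` for fixed `K`. Earlier blocks contribute a bounded
amount and later ones nothing, so ranks growing fast enough make `|T_{M+2} f|` large at every point.

Kernels are functions of two variables `x`, `t`; the group structure enters only in the proof that
the blocks have mean zero. -/

namespace Vilenkin

/-! ### Functions of finitely many coordinates -/

/-- The function `f` depends only on the first `n` coordinates. -/
def FirstCoords (m : ℕ → ℕ) (n : ℕ) {α : Type*} (f : VilenkinGroup m → α) : Prop :=
  ∀ x y, y ∈ interval m n x → f y = f x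

/-- The labels of the intervals of rank `n`. -/
abbrev Label (m : ℕ → ℕ) (n : ℕ) : Type := ∀ i : Fin n, ZMod (m i)

/-- The point with prescribed first `n` coordinates, all others being zero. -/
def ext (m : ℕ → ℕ) (n : ℕ) (j : Label m n) : VilenkinGroup m :=
  fun k => if h : k < n then j ⟨k, h⟩ else 0

/-- The label of the interval of rank `n` around a point. -/
def res (m : ℕ → ℕ) (n : ℕ) (x : VilenkinGroup m) : Label m n := fun i => x i

variable {m : ℕ → ℕ}

theorem mem_interval {n : ℕ} {x y : VilenkinGroup m} :
    y ∈ interval m n x ↔ ∀ i < n, y i = x i := Iff.rfl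

theorem mem_interval_self (n : ℕ) (x : VilenkinGroup m) : x ∈ interval m n x := fun _ _ => rfl

theorem mem_interval_comm {n : ℕ} {x y : VilenkinGroup m} :
    y ∈ interval m n x ↔ x ∈ interval m n y :=
  ⟨fun h i hi => (h i hi).symm, fun h i hi => (h i hi).symm⟩

theorem mem_interval_trans {n : ℕ} {x y z : VilenkinGroup m} (h : y ∈ interval m n x)
    (h' : z ∈ interval m n y) : z ∈ interval m n x :=
  fun i hi => (h' i hi).trans (h i hi)

theorem interval_anti {n k : ℕ} (h : n ≤ k) (x : VilenkinGroup m) :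
    interval m k x ⊆ interval m n x := fun _ hy i hi => hy i (hi.trans_le h)

theorem mem_interval_ext_iff {n : ℕ} {j : Label m n} {x : VilenkinGroup m} :
    x ∈ interval m n (ext m n j) ↔ j = res m n x := by
  constructor
  · intro h
    funext i
    have := h i i.2
    simp [ext] at this
    exact this.symm
  · rintro rfl i hi
    simp [ext, res, hi]

theorem mem_interval_ext_res (n : ℕ) (x : VilenkinGroup m) :
    x ∈ interval m n (ext m n (res m n x)) := mem_interval_ext_iff.2 rfl

theorem FirstCoords.mono {α : Type*} {f : VilenkinGroup m → α} {n k : ℕ} (h : n ≤ k)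
    (hf : FirstCoords m n f) : FirstCoords m k f :=
  fun x y hy => hf x y (interval_anti h x hy)

theorem FirstCoords.ext_res {α : Type*} {f : VilenkinGroup m → α} {n : ℕ}
    (hf : FirstCoords m n f) (x : VilenkinGroup m) : f (ext m n (res m n x)) = f x :=
  (hf _ _ (mem_interval_ext_res n x)).symm

theorem measurableSet_interval (n : ℕ) (x : VilenkinGroup m) :
    MeasurableSet (interval m n x) := by
  have : interval m n x = ⋂ i ∈ Finset.range n, (fun y : VilenkinGroup m => y i) ⁻¹' {x i} := by
    ext y; simp [interval]
  rw [this]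
  exact Finset.measurableSet_biInter _ fun i _ => measurable_pi_apply i (measurableSet_singleton _)

variable [∀ k, NeZero (m k)]

theorem FirstCoords.measurable_filtration {α : Type*} [MeasurableSpace α]
    {f : VilenkinGroup m → α} {n : ℕ} (hf : FirstCoords m n f) :
    Measurable[filtration m n] f := by
  have : f = (fun j => f (ext m n j)) ∘ res m n := by
    funext x; exact (hf.ext_res x).symm
  rw [this]
  exact (measurable_of_countable _).comp (comap_measurable _)

theorem FirstCoords.measurable {α : Type*} [MeasurableSpace α]
    {f : VilenkinGroup m → α} {n : ℕ} (hf : FirstCoords m n f) : Measurable f :=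
  hf.measurable_filtration.mono ((filtration m).le n) le_rfl

theorem FirstCoords.measurableSet {n : ℕ} {s : Set (VilenkinGroup m)}
    (hs : FirstCoords m n (· ∈ s)) : MeasurableSet[filtration m n] s := by
  have := hs.measurable_filtration (α := Prop) (measurableSet_singleton True)
  simpa [Set.preimage] using this

omit [∀ k, NeZero (m k)] in
-- The fibre of `f` through `x` is a preimage under the restriction map, so it contains all of
-- `I_n(x)`. Measurability at time `n` thus becomes a pointwise statement with no null sets.
theorem firstCoords_of_measurable {α : Type*} [MeasurableSpace α] [MeasurableSingletonClass α]
    {f : VilenkinGroup m → α} {n : ℕ} (hf : Measurable[filtration m n] f) :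
    FirstCoords m n f := by
  intro x y hy
  obtain ⟨T, -, hT⟩ := hf (measurableSet_singleton (f x))
  have hx : x ∈ f ⁻¹' {f x} := rfl
  rw [← hT] at hx
  have hy' : y ∈ f ⁻¹' {f x} := by
    rw [← hT]
    have : (fun i : Fin n => y i) = fun i : Fin n => x i := by
      funext i; exact hy i i.2
    simpa [this] using hx
  exact hy'

theorem FirstCoords.exists_bound {f : VilenkinGroup m → ℂ} {n : ℕ} (hf : FirstCoords m n f) :
    ∃ C : ℝ, ∀ x, ‖f x‖ ≤ C := by
  obtain ⟨C, hC⟩ := (Set.finite_range fun j : Label m n => ‖f (ext m n j)‖).bddAbove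
  exact ⟨C, fun x => by rw [← hf.ext_res x]; exact hC ⟨_, rfl⟩⟩

theorem FirstCoords.integrable {f : VilenkinGroup m → ℂ} {n : ℕ} (hf : FirstCoords m n f) :
    Integrable f (haar m) := by
  obtain ⟨C, hC⟩ := hf.exists_bound
  exact .of_bound hf.measurable.aestronglyMeasurable C (.of_forall hC)

omit [∀ k, NeZero (m k)] in
theorem FirstCoords.comp₂ {α β γ : Type*} {f : VilenkinGroup m → α} {g : VilenkinGroup m → β}
    {n : ℕ} (hf : FirstCoords m n f) (hg : FirstCoords m n g) (F : α → β → γ) :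
    FirstCoords m n fun x => F (f x) (g x) := by
  intro x y h
  simp only [hf x y h, hg x y h]

omit [∀ k, NeZero (m k)] in
theorem FirstCoords.comp {α β : Type*} {f : VilenkinGroup m → α}
    {n : ℕ} (hf : FirstCoords m n f) (F : α → β) :
    FirstCoords m n fun x => F (f x) := by
  intro x y h
  simp only [hf x y h]

omit [∀ k, NeZero (m k)] in
theorem firstCoords_mem_interval {n k : ℕ} (h : k ≤ n) (x : VilenkinGroup m) :
    FirstCoords m n (· ∈ interval m k x) := by
  intro y z hz
  refine propext ⟨fun h' => ?_, fun h' => ?_⟩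
  · exact mem_interval_trans h' (mem_interval_comm.1 (interval_anti h _ hz))
  · exact mem_interval_trans h' (interval_anti h _ hz)

/-- A function is the sum of its restrictions to the intervals of rank `n`. -/
theorem sum_indicator_interval {E : Type*} [AddCommMonoid E] (n : ℕ) (f : VilenkinGroup m → E)
    (x : VilenkinGroup m) :
    ∑ j : Label m n, (interval m n (ext m n j)).indicator f x = f x := by
  classical
  simp only [Set.indicator_apply, mem_interval_ext_iff]
  simp

/-- `g` is constant on each interval of rank `n` and leaves the integral there. This orthogonality
serves both martingale differences and the blocks of part b). -/
theorem integral_mul_eq_zero {n : ℕ} {u g : VilenkinGroup m → ℂ} (hu : Integrable u (haar m))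
    (hg : FirstCoords m n g) (h : ∀ y, ∫ x in interval m n y, u x ∂(haar m) = 0) :
    ∫ x, u x * g x ∂(haar m) = 0 := by
  have hug : Integrable (fun x => u x * g x) (haar m) := by
    obtain ⟨C, hC⟩ := hg.exists_bound
    exact hu.mul_bdd hg.measurable.aestronglyMeasurable (.of_forall hC)
  rw [show (fun x => u x * g x) = fun x => ∑ j : Label m n,
    (interval m n (ext m n j)).indicator (fun x => u x * g x) x from
    funext fun x => (sum_indicator_interval n (fun x => u x * g x) x).symm]
  rw [integral_finsetSum _ fun j _ => hug.indicator (measurableSet_interval _ _)]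
  refine Finset.sum_eq_zero fun j _ => ?_
  rw [integral_indicator (measurableSet_interval _ _)]
  have : ∀ x ∈ interval m n (ext m n j), u x * g x = u x * g (ext m n j) := fun x hx => by
    rw [hg _ _ hx]
  rw [setIntegral_congr_fun (measurableSet_interval _ _) this, integral_mul_const, h, zero_mul]

/-! ### The measure of boxes -/

theorem bigM_pos (n : ℕ) : 0 < bigM m n := by
  induction n with
  | zero => simp [bigM]
  | succ n ih => exact Nat.mul_pos (NeZero.pos _) ih

theorem bigM_mono : Monotone (bigM m) :=
  monotone_nat_of_le_succ fun n => Nat.le_mul_of_pos_left _ (NeZero.pos (m n))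

omit [∀ k, NeZero (m k)] in
theorem bigM_dvd {a b : ℕ} (h : a ≤ b) : bigM m a ∣ bigM m b := by
  induction b, h using Nat.le_induction with
  | base => exact dvd_rfl
  | succ n _ ih => exact ih.mul_left _

theorem haar_box (S : Finset ℕ) (x : VilenkinGroup m) :
    haar m {t | ∀ i ∈ S, t i = x i} = ∏ i ∈ S, (m i : ℝ≥0∞)⁻¹ := by
  have : {t : VilenkinGroup m | ∀ i ∈ S, t i = x i} = (S : Set ℕ).pi fun i => {x i} := by
    ext t; simp [Set.mem_pi]
  rw [this, haar, Measure.infinitePi_pi _ fun i _ => measurableSet_singleton _]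
  simp [factorMeasure]

theorem bigM_cast_ne_zero (n : ℕ) : (bigM m n : ℝ≥0∞) ≠ 0 := by
  exact_mod_cast (bigM_pos n).ne'

omit [∀ k, NeZero (m k)] in
theorem bigM_cast_ne_top (n : ℕ) : (bigM m n : ℝ≥0∞) ≠ ∞ := ENNReal.natCast_ne_top _

omit [∀ k, NeZero (m k)] in
theorem prod_inv_range (n : ℕ) :
    ∏ i ∈ Finset.range n, (m i : ℝ≥0∞)⁻¹ = (bigM m n : ℝ≥0∞)⁻¹ := by
  induction n with
  | zero => simp [bigM]
  | succ n ih =>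
    rw [Finset.prod_range_succ, ih, bigM, Nat.cast_mul, ENNReal.mul_inv, mul_comm]
    · right; exact bigM_cast_ne_top n
    · left; exact ENNReal.natCast_ne_top _

theorem haar_interval (n : ℕ) (x : VilenkinGroup m) :
    haar m (interval m n x) = (bigM m n : ℝ≥0∞)⁻¹ := by
  rw [← prod_inv_range, ← haar_box _ x]
  simp [interval]

/-- The points that agree with `x` in the coordinates below `n`, except possibly the `s`-th. -/
def near (m : ℕ → ℕ) (n s : ℕ) (x : VilenkinGroup m) : Set (VilenkinGroup m) :=
  {t | ∀ i < n, i ≠ s → t i = x i}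

omit [∀ k, NeZero (m k)] in
theorem near_comm {n s : ℕ} {x t : VilenkinGroup m} : t ∈ near m n s x ↔ x ∈ near m n s t :=
  ⟨fun h i hi hs => (h i hi hs).symm, fun h i hi hs => (h i hi hs).symm⟩

omit [∀ k, NeZero (m k)] in
theorem near_eq_box (n s : ℕ) (x : VilenkinGroup m) :
    near m n s x = {t | ∀ i ∈ (Finset.range n).erase s, t i = x i} := by
  ext t
  simp only [near, Set.mem_ofPred_eq, Finset.mem_erase, Finset.mem_range]
  exact ⟨fun h i hi => h i hi.2 hi.1, fun h i h1 h2 => h i ⟨h2, h1⟩⟩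

omit [∀ k, NeZero (m k)] in
theorem firstCoords_mem_near (n s : ℕ) (x : VilenkinGroup m) :
    FirstCoords m n (· ∈ near m n s x) := by
  intro y z hz
  refine propext ⟨fun h i hi hs => ?_, fun h i hi hs => ?_⟩
  · rw [← hz i hi, h i hi hs]
  · rw [hz i hi, h i hi hs]

theorem measurableSet_near (n s : ℕ) (x : VilenkinGroup m) : MeasurableSet (near m n s x) :=
  (filtration m).le n _ (firstCoords_mem_near n s x).measurableSet

/-- Freeing one coordinate multiplies the measure of the interval by `m_s ≤ b`; for `s ≥ n` nothing
is freed. -/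
theorem haar_near_le {b : ℕ} (hb : ∀ k, m k ≤ b) (n s : ℕ) (x : VilenkinGroup m) :
    haar m (near m n s x) ≤ b * (bigM m n : ℝ≥0∞)⁻¹ := by
  rw [near_eq_box, haar_box, ← prod_inv_range]
  have hb1 : (1 : ℝ≥0∞) ≤ b := by
    exact_mod_cast (NeZero.pos (m 0)).trans_le (hb 0)
  by_cases hs : s ∈ Finset.range n
  · rw [← Finset.mul_prod_erase _ _ hs, ← mul_assoc]
    refine le_mul_of_one_le_left' ?_
    have h0 : (m s : ℝ≥0∞) ≠ 0 := by exact_mod_cast NeZero.ne (m s)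
    rw [← ENNReal.mul_inv_cancel h0 (ENNReal.natCast_ne_top _)]
    gcongr
    exact_mod_cast hb s
  · rw [Finset.erase_eq_of_notMem hs]
    exact le_mul_of_one_le_left' hb1

end Vilenkin

/-! ### Kernels, and a majorant of the Fejér kernels by indicators of boxes. -/

namespace Vilenkin

/-! ### Dirichlet and Fejér kernels in two variables -/

/-- The product `r_k(x) * conj r_k(t)`. -/
noncomputable def rho (m : ℕ → ℕ) (k : ℕ) (x t : VilenkinGroup m) : ℂ :=
  rademacher m k x * (starRingEnd ℂ) (rademacher m k t)

/-- The product `ψ_n(x) * conj ψ_n(t)`. -/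
noncomputable def psiTwo (m : ℕ → ℕ) (n : ℕ) (x t : VilenkinGroup m) : ℂ :=
  psi m n x * (starRingEnd ℂ) (psi m n t)

/-- The Dirichlet kernel. -/
noncomputable def dirichlet (m : ℕ → ℕ) (n : ℕ) (x t : VilenkinGroup m) : ℂ :=
  ∑ i ∈ Finset.range n, psiTwo m i x t

/-- The unnormalized Fejér kernel. -/
noncomputable def fejer (m : ℕ → ℕ) (n : ℕ) (x t : VilenkinGroup m) : ℂ :=
  ∑ k ∈ Finset.range n, dirichlet m k x t

variable {m : ℕ → ℕ}

theorem firstCoords_rademacher (k : ℕ) : FirstCoords m (k + 1) (rademacher m k) := by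
  intro x y h
  simp only [rademacher, h k (Nat.lt_succ_self k)]

theorem norm_rademacher (k : ℕ) (x : VilenkinGroup m) : ‖rademacher m k x‖ = 1 := by
  have : (2 * Real.pi * Complex.I * ((x k).val : ℂ) / (m k : ℂ)) =
      ((2 * Real.pi * ((x k).val : ℝ) / (m k : ℝ) : ℝ) : ℂ) * Complex.I := by
    push_cast; ring
  rw [rademacher, this, Complex.norm_exp_ofReal_mul_I]

theorem norm_rho (k : ℕ) (x t : VilenkinGroup m) : ‖rho m k x t‖ = 1 := by
  rw [rho, norm_mul, RCLike.norm_conj, norm_rademacher, norm_rademacher, one_mul]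

theorem norm_psi (n : ℕ) (x : VilenkinGroup m) : ‖psi m n x‖ = 1 := by
  simp [psi, norm_prod, norm_pow, norm_rademacher]

theorem psi_zero (x : VilenkinGroup m) : psi m 0 x = 1 := by simp [psi]

theorem digit_eq_zero_of_lt {n k K : ℕ} [∀ k, NeZero (m k)] (h : n < bigM m K) (hk : K ≤ k) :
    digit m k n = 0 := by
  simp [digit, Nat.div_eq_of_lt (h.trans_le (bigM_mono hk))]

variable [∀ k, NeZero (m k)]

theorem rademacher_pow_eq_one (k : ℕ) (x : VilenkinGroup m) : rademacher m k x ^ m k = 1 := by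
  have h : (m k : ℂ) ≠ 0 := by exact_mod_cast NeZero.ne (m k)
  rw [rademacher, ← Complex.exp_nat_mul, Complex.exp_eq_one_iff]
  exact ⟨(x k).val, by push_cast; field_simp⟩

theorem rho_pow_eq_one (k : ℕ) (x t : VilenkinGroup m) : rho m k x t ^ m k = 1 := by
  rw [rho, mul_pow, ← map_pow, rademacher_pow_eq_one, rademacher_pow_eq_one, map_one, one_mul]

theorem rademacher_inj {k : ℕ} {x t : VilenkinGroup m}
    (h : rademacher m k x = rademacher m k t) : x k = t k := by
  have h0 : (m k : ℂ) ≠ 0 := by exact_mod_cast NeZero.ne (m k)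
  obtain ⟨n, hn⟩ := Complex.exp_eq_exp_iff_exists_int.1 h
  have h2 : (2 * Real.pi * Complex.I : ℂ) ≠ 0 := Complex.two_pi_I_ne_zero
  have h3 : ((x k).val : ℂ) = (t k).val + n * m k := by
    field_simp at hn
    have : (2 * Real.pi * Complex.I : ℂ) * (x k).val =
        (2 * Real.pi * Complex.I) * ((t k).val + n * m k) := by
      linear_combination (2 * Real.pi * Complex.I : ℂ) * hn
    exact mul_left_cancel₀ h2 this
  have h4 : ((x k).val : ℤ) = (t k).val + n * m k := by exact_mod_cast h3
  have h5 := congrArg (Int.cast : ℤ → ZMod (m k)) h4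
  simpa using h5

theorem rho_eq_one_iff {k : ℕ} {x t : VilenkinGroup m} : rho m k x t = 1 ↔ x k = t k := by
  have hself : ∀ t : VilenkinGroup m,
      rademacher m k t * (starRingEnd ℂ) (rademacher m k t) = 1 := by
    intro t
    rw [Complex.mul_conj, Complex.normSq_eq_norm_sq, norm_rademacher]; norm_num
  constructor
  · intro h
    refine rademacher_inj ?_
    calc rademacher m k x = rademacher m k x *
          ((starRingEnd ℂ) (rademacher m k t) * rademacher m k t) := by
            rw [mul_comm ((starRingEnd ℂ) _), hself, mul_one]
      _ = rho m k x t * rademacher m k t := by rw [rho, mul_assoc]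
      _ = _ := by rw [h, one_mul]
  · intro h
    have : rademacher m k x = rademacher m k t := by simp only [rademacher, h]
    rw [rho, this, hself]

open Classical in
theorem sum_rho_pow (k : ℕ) (x t : VilenkinGroup m) :
    ∑ s ∈ Finset.range (m k), rho m k x t ^ s = if x k = t k then (m k : ℂ) else 0 := by
  split_ifs with h
  · simp [rho_eq_one_iff.2 h]
  · have h1 : rho m k x t ≠ 1 := fun h' => h (rho_eq_one_iff.1 h')
    rw [geom_sum_eq h1, rho_pow_eq_one, sub_self, zero_div]

theorem psi_eq_prod {n K : ℕ} (h : n < bigM m K) (hm : ∀ k, 2 ≤ m k) (x : VilenkinGroup m) :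
    psi m n x = ∏ k ∈ Finset.range K, rademacher m k x ^ digit m k n := by
  rcases le_total n K with hnK | hnK
  · refine Finset.prod_subset (Finset.range_mono hnK) fun k _ hk => ?_
    rw [digit_eq_zero m hm (by simpa using hk), pow_zero]
  · refine (Finset.prod_subset (Finset.range_mono hnK) fun k _ hk => ?_).symm
    rw [digit_eq_zero_of_lt h (by simpa using hk), pow_zero]

theorem firstCoords_psi (hm : ∀ k, 2 ≤ m k) {n K : ℕ} (h : n < bigM m K) :
    FirstCoords m K (psi m n) := by
  intro x y hxy
  rw [psi_eq_prod h hm, psi_eq_prod h hm]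
  refine Finset.prod_congr rfl fun k hk => ?_
  rw [(firstCoords_rademacher k).mono (Finset.mem_range.1 hk) x y hxy]

theorem digit_mul_add {A j i k : ℕ} (hk : k < A) :
    digit m k (j * bigM m A + i) = digit m k i := by
  obtain ⟨c, hc⟩ := bigM_dvd (m := m) (show k + 1 ≤ A from hk)
  have hp : 0 < bigM m k := bigM_pos k
  have : j * bigM m A + i = i + bigM m k * (m k * (j * c)) := by
    rw [hc, bigM]; ring
  rw [digit, this, Nat.add_mul_div_left _ _ hp, Nat.add_mul_mod_self_left, digit]

theorem digit_mul_add_self {A j i : ℕ} (hj : j < m A) (hi : i < bigM m A) :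
    digit m A (j * bigM m A + i) = j := by
  rw [digit, Nat.add_comm, Nat.add_mul_div_right _ _ (bigM_pos A), Nat.div_eq_of_lt hi, zero_add,
    Nat.mod_eq_of_lt hj]

theorem psi_mul_add (hm : ∀ k, 2 ≤ m k) {A j i : ℕ} (hj : j < m A) (hi : i < bigM m A)
    (x : VilenkinGroup m) :
    psi m (j * bigM m A + i) x = rademacher m A x ^ j * psi m i x := by
  have h : j * bigM m A + i < bigM m (A + 1) := by
    have : (j + 1) * bigM m A ≤ m A * bigM m A := Nat.mul_le_mul_right _ hj
    rw [bigM]; nlinarith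
  rw [psi_eq_prod h hm, psi_eq_prod hi hm, Finset.prod_range_succ, digit_mul_add_self hj hi,
    mul_comm]
  congr 1
  refine Finset.prod_congr rfl fun k hk => ?_
  rw [digit_mul_add (Finset.mem_range.1 hk)]

theorem psi_bigM (hm : ∀ k, 2 ≤ m k) (A : ℕ) (x : VilenkinGroup m) :
    psi m (bigM m A) x = rademacher m A x := by
  have := psi_mul_add hm (A := A) (j := 1) (i := 0) (hm A) (bigM_pos A) x
  simpa [psi_zero] using this

theorem psiTwo_mul_add (hm : ∀ k, 2 ≤ m k) {A j i : ℕ} (hj : j < m A) (hi : i < bigM m A)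
    (x t : VilenkinGroup m) :
    psiTwo m (j * bigM m A + i) x t = rho m A x t ^ j * psiTwo m i x t := by
  simp only [psiTwo, psi_mul_add hm hj hi, rho, map_mul, map_pow, mul_pow]
  ring

theorem dirichlet_mul_add (hm : ∀ k, 2 ≤ m k) {A j i : ℕ} (hj : j < m A) (hi : i ≤ bigM m A)
    (x t : VilenkinGroup m) :
    dirichlet m (j * bigM m A + i) x t =
      dirichlet m (j * bigM m A) x t + rho m A x t ^ j * dirichlet m i x t := by
  rw [dirichlet, Finset.sum_range_add, dirichlet, dirichlet, Finset.mul_sum]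
  congr 1
  refine Finset.sum_congr rfl fun k hk => ?_
  exact psiTwo_mul_add hm hj ((Finset.mem_range.1 hk).trans_le hi) x t

theorem dirichlet_mul (hm : ∀ k, 2 ≤ m k) {A j : ℕ} (hj : j ≤ m A) (x t : VilenkinGroup m) :
    dirichlet m (j * bigM m A) x t =
      (∑ s ∈ Finset.range j, rho m A x t ^ s) * dirichlet m (bigM m A) x t := by
  induction j with
  | zero => simp [dirichlet]
  | succ j ih =>
    rw [add_mul, one_mul, dirichlet_mul_add hm hj le_rfl, ih (Nat.le_of_succ_le hj),
      Finset.sum_range_succ, add_mul]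

/-- Paley's lemma: each new digit multiplies the kernel by a full sum of powers of an `m_A`-th root
of unity, which vanishes unless the `A`-th coordinates agree. -/
theorem dirichlet_bigM (hm : ∀ k, 2 ≤ m k) (A : ℕ) (x t : VilenkinGroup m) :
    dirichlet m (bigM m A) x t = (interval m A x).indicator (fun _ => (bigM m A : ℂ)) t := by
  classical
  induction A with
  | zero =>
    have : t ∈ interval m 0 x := fun i hi => absurd hi (Nat.not_lt_zero i)
    simp [bigM, dirichlet, psiTwo, psi_zero, this]
  | succ A ih =>
    rw [bigM, dirichlet_mul hm le_rfl, ih, sum_rho_pow]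
    simp only [Set.indicator_apply, mem_interval, Nat.forall_lt_succ_right]
    by_cases h1 : x A = t A <;> simp [h1, eq_comm]

theorem fejer_mul_add (hm : ∀ k, 2 ≤ m k) {A j i : ℕ} (hj : j < m A) (hi : i ≤ bigM m A)
    (x t : VilenkinGroup m) :
    fejer m (j * bigM m A + i) x t = fejer m (j * bigM m A) x t +
      i * dirichlet m (j * bigM m A) x t + rho m A x t ^ j * fejer m i x t := by
  rw [fejer, Finset.sum_range_add, fejer, fejer, Finset.mul_sum, add_assoc]
  congr 1
  rw [Finset.sum_congr rfl fun k hk =>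
    dirichlet_mul_add hm hj ((Finset.mem_range.1 hk).le.trans hi) x t]
  rw [Finset.sum_add_distrib, Finset.sum_const, Finset.card_range, nsmul_eq_mul]

theorem fejer_mul (hm : ∀ k, 2 ≤ m k) {A j : ℕ} (hj : j ≤ m A) (x t : VilenkinGroup m) :
    fejer m (j * bigM m A) x t =
      bigM m A * ∑ l ∈ Finset.range j, dirichlet m (l * bigM m A) x t +
      (∑ l ∈ Finset.range j, rho m A x t ^ l) * fejer m (bigM m A) x t := by
  induction j with
  | zero => simp [fejer]
  | succ j ih =>
    rw [add_mul, one_mul, fejer_mul_add hm hj le_rfl, ih (Nat.le_of_succ_le hj),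
      Finset.sum_range_succ, Finset.sum_range_succ]
    ring

/-! ### A majorant of the Fejér kernel -/

/-- The majorant `∑_{s ≤ B} M_B M_s 1{x_i = t_i for i < B, i ≠ s}` of `M_B` times the
`M_B`-th Fejér kernel. -/
noncomputable def majorant (m : ℕ → ℕ) (B : ℕ) (x t : VilenkinGroup m) : ℝ≥0∞ :=
  ∑ s ∈ Finset.range (B + 1), (near m B s x).indicator (fun _ => (bigM m B * bigM m s : ℝ≥0∞)) t

theorem enorm_natCast (n : ℕ) : ‖(n : ℂ)‖ₑ = n := by
  rw [← ofReal_norm]; simp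

theorem enorm_dirichlet_bigM (hm : ∀ k, 2 ≤ m k) (A : ℕ) (x t : VilenkinGroup m) :
    ‖dirichlet m (bigM m A) x t‖ₑ =
      (interval m A x).indicator (fun _ => (bigM m A : ℝ≥0∞)) t := by
  rw [dirichlet_bigM hm]
  by_cases h : t ∈ interval m A x <;> simp [h, enorm_natCast]

omit [∀ k, NeZero (m k)] in
theorem near_self (n : ℕ) (x : VilenkinGroup m) : near m n n x = interval m n x := by
  ext t
  exact ⟨fun h i hi => h i hi hi.ne, fun h i hi _ => h i hi⟩

theorem bigM_mul_enorm_dirichlet_le (hm : ∀ k, 2 ≤ m k) (A : ℕ) (x t : VilenkinGroup m) :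
    bigM m A * ‖dirichlet m (bigM m A) x t‖ₑ ≤ majorant m A x t := by
  rw [enorm_dirichlet_bigM hm, majorant, Finset.sum_range_succ, near_self]
  refine le_trans ?_ le_add_self
  by_cases h : t ∈ interval m A x <;> simp [h]

omit [∀ k, NeZero (m k)] in
theorem enorm_rho_pow (k s : ℕ) (x t : VilenkinGroup m) : ‖rho m k x t ^ s‖ₑ = 1 := by
  rw [← ofReal_norm, norm_pow, norm_rho]; simp

omit [∀ k, NeZero (m k)] in
theorem enorm_sum_rho_pow_le (k j : ℕ) (x t : VilenkinGroup m) :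
    ‖∑ s ∈ Finset.range j, rho m k x t ^ s‖ₑ ≤ j := by
  refine (enorm_sum_le _ _).trans ?_
  simp only [enorm_rho_pow]
  simp

theorem enorm_dirichlet_mul_le (hm : ∀ k, 2 ≤ m k) {A j : ℕ} (hj : j ≤ m A)
    (x t : VilenkinGroup m) :
    ‖dirichlet m (j * bigM m A) x t‖ₑ ≤ j * ‖dirichlet m (bigM m A) x t‖ₑ := by
  rw [dirichlet_mul hm hj, enorm_mul]
  gcongr
  exact enorm_sum_rho_pow_le _ _ _ _

theorem enorm_sum_dirichlet_le (hm : ∀ k, 2 ≤ m k) {A j : ℕ} (hj : j ≤ m A)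
    (x t : VilenkinGroup m) :
    ‖∑ l ∈ Finset.range j, dirichlet m (l * bigM m A) x t‖ₑ ≤
      m A * m A * ‖dirichlet m (bigM m A) x t‖ₑ := by
  refine (enorm_sum_le _ _).trans ?_
  calc ∑ l ∈ Finset.range j, ‖dirichlet m (l * bigM m A) x t‖ₑ
      ≤ ∑ l ∈ Finset.range j, m A * ‖dirichlet m (bigM m A) x t‖ₑ := by
        refine Finset.sum_le_sum fun l hl => ?_
        have hl' : l ≤ m A := (Finset.mem_range.1 hl).le.trans hj
        refine (enorm_dirichlet_mul_le hm hl' x t).trans ?_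
        gcongr
    _ = j * (m A * ‖dirichlet m (bigM m A) x t‖ₑ) := by simp
    _ ≤ _ := by rw [mul_assoc]; gcongr

/-- Induction on the rank, through `fejer_mul` with `j = m_A`. The Dirichlet part yields the new
summand `s = A`, where the coordinate `A` is free. The factor `m_A 1{x_A = t_A}` carries the old
summands `s < A` to the same `s` at rank `A + 1`, and the old `s = A` into `s = A + 1`. No summand
is used twice, so the constant `b` does not grow. -/
theorem enorm_fejer_bigM_le (hm : ∀ k, 2 ≤ m k) {b : ℕ} (hb : ∀ k, m k ≤ b) (A : ℕ)
    (x t : VilenkinGroup m) : ‖fejer m (bigM m A) x t‖ₑ ≤ b * majorant m A x t := by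
  classical
  induction A with
  | zero => simp [bigM, fejer, dirichlet]
  | succ A ih =>
    have hb1 : (1 : ℝ≥0∞) ≤ b := by exact_mod_cast (NeZero.pos (m 0)).trans_le (hb 0)
    have h1 : ‖fejer m (bigM m (A + 1)) x t‖ₑ ≤
        bigM m A * (m A * m A * ‖dirichlet m (bigM m A) x t‖ₑ) +
        (if x A = t A then (m A : ℝ≥0∞) else 0) * (b * majorant m A x t) := by
      rw [bigM, fejer_mul hm le_rfl]
      refine (enorm_add_le _ _).trans ?_
      rw [enorm_mul, enorm_mul, enorm_natCast, sum_rho_pow]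
      gcongr
      · exact enorm_sum_dirichlet_le hm le_rfl x t
      · split_ifs <;> simp [enorm_natCast]
    refine h1.trans ?_
    rw [enorm_dirichlet_bigM hm, majorant, majorant, Finset.sum_range_succ _ (A + 1),
      Finset.sum_range_succ _ A, Finset.sum_range_succ _ A]
    have e1 : (interval m A x).indicator (fun _ => (bigM m A : ℝ≥0∞)) t * m A * bigM m A ≤
        (near m (A + 1) A x).indicator
          (fun _ => (bigM m (A + 1) * bigM m A : ℝ≥0∞)) t := by
      by_cases h : t ∈ interval m A x
      · have : t ∈ near m (A + 1) A x := fun i hi hne => h i (by omega)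
        simp only [h, this, Set.indicator_of_mem, bigM, Nat.cast_mul]
        exact le_of_eq (by ring)
      · simp [h]
    have e2 : (if x A = t A then (m A : ℝ≥0∞) else 0) *
        (near m A A x).indicator (fun _ => (bigM m A * bigM m A : ℝ≥0∞)) t ≤
        (near m (A + 1) (A + 1) x).indicator
          (fun _ => (bigM m (A + 1) * bigM m (A + 1) : ℝ≥0∞)) t := by
      rw [near_self, near_self]
      split_ifs with hA
      · by_cases h : t ∈ interval m A x
        · have h' : t ∈ interval m (A + 1) x := by
            intro i hi
            rcases Nat.lt_succ_iff_lt_or_eq.1 hi with h2 | rfl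
            · exact h i h2
            · exact hA.symm
          simp only [h, h', Set.indicator_of_mem]
          rw [show (bigM m (A + 1) : ℝ≥0∞) = m A * bigM m A by rw [bigM, Nat.cast_mul]]
          have : (1 : ℝ≥0∞) ≤ m A := by exact_mod_cast NeZero.pos (m A)
          calc (m A * (bigM m A * bigM m A) : ℝ≥0∞) = m A * bigM m A * (1 * bigM m A) := by ring
            _ ≤ _ := by gcongr
        · simp [h]
      · simp
    have e3 : (if x A = t A then (m A : ℝ≥0∞) else 0) *
        ∑ s ∈ Finset.range A, (near m A s x).indicator
          (fun _ => (bigM m A * bigM m s : ℝ≥0∞)) t ≤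
        ∑ s ∈ Finset.range A, (near m (A + 1) s x).indicator
          (fun _ => (bigM m (A + 1) * bigM m s : ℝ≥0∞)) t := by
      rw [Finset.mul_sum]
      refine Finset.sum_le_sum fun s _ => ?_
      split_ifs with hA
      · by_cases h : t ∈ near m A s x
        · have h' : t ∈ near m (A + 1) s x := by
            intro i hi hs
            rcases Nat.lt_succ_iff_lt_or_eq.1 hi with h2 | rfl
            · exact h i h2 hs
            · exact hA.symm
          simp only [h, h', Set.indicator_of_mem, bigM, Nat.cast_mul]
          exact le_of_eq (by ring)
        · simp [h]
      · simp
    calc _ = m A * ((interval m A x).indicator (fun _ => (bigM m A : ℝ≥0∞)) t * m A * bigM m A) +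
          b * ((if x A = t A then (m A : ℝ≥0∞) else 0) *
            ∑ s ∈ Finset.range A, (near m A s x).indicator
              (fun _ => (bigM m A * bigM m s : ℝ≥0∞)) t +
          (if x A = t A then (m A : ℝ≥0∞) else 0) *
            (near m A A x).indicator (fun _ => (bigM m A * bigM m A : ℝ≥0∞)) t) := by ring
      _ ≤ b * (near m (A + 1) A x).indicator
          (fun _ => (bigM m (A + 1) * bigM m A : ℝ≥0∞)) t + b * (
            ∑ s ∈ Finset.range A, (near m (A + 1) s x).indicator
              (fun _ => (bigM m (A + 1) * bigM m s : ℝ≥0∞)) t +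
            (near m (A + 1) (A + 1) x).indicator
              (fun _ => (bigM m (A + 1) * bigM m (A + 1) : ℝ≥0∞)) t) := by
          gcongr
          exact hb A
      _ = _ := by ring

/-- Peel off the leading digit, `n = j M_K + i`. Three of the resulting terms are each at most `b²`
times the majorant of rank `K`, and the remaining one has index `i < M_K`. -/
theorem enorm_fejer_le (hm : ∀ k, 2 ≤ m k) {b : ℕ} (hb : ∀ k, m k ≤ b) (K : ℕ)
    {n : ℕ} (hn : n < bigM m K) (x t : VilenkinGroup m) :
    ‖fejer m n x t‖ₑ ≤ 3 * b ^ 2 * ∑ B ∈ Finset.range K, majorant m B x t := by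
  induction K generalizing n with
  | zero =>
    have : n = 0 := by simpa [bigM] using hn
    simp [this, fejer]
  | succ K ih =>
    set j := n / bigM m K with hj
    set i := n % bigM m K with hi
    have hn' : n = j * bigM m K + i := (Nat.div_add_mod' n _).symm
    have hjm : j < m K := by
      rw [hj, Nat.div_lt_iff_lt_mul (bigM_pos K)]; exact hn
    have hib : i < bigM m K := Nat.mod_lt _ (bigM_pos K)
    have hb1 : (1 : ℝ≥0∞) ≤ b := by exact_mod_cast (NeZero.pos (m 0)).trans_le (hb 0)
    have hmb : (m K : ℝ≥0∞) ≤ b := by exact_mod_cast hb K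
    have hjb : (j : ℝ≥0∞) ≤ b := by exact_mod_cast hjm.le.trans (hb K)
    have hV := bigM_mul_enorm_dirichlet_le hm K x t
    rw [hn', fejer_mul_add hm hjm hib.le, fejer_mul hm hjm.le]
    refine (enorm_add_le _ _).trans ?_
    refine (add_le_add_left ((enorm_add_le _ _).trans
      (add_le_add_left (enorm_add_le _ _) _)) _).trans ?_
    simp only [enorm_mul, enorm_natCast, enorm_rho_pow, one_mul]
    rw [Finset.sum_range_succ]
    have a1 : (bigM m K : ℝ≥0∞) * ‖∑ l ∈ Finset.range j, dirichlet m (l * bigM m K) x t‖ₑ ≤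
        b ^ 2 * majorant m K x t := by
      calc _ ≤ (bigM m K : ℝ≥0∞) * (m K * m K * ‖dirichlet m (bigM m K) x t‖ₑ) := by
            gcongr; exact enorm_sum_dirichlet_le hm hjm.le x t
        _ = m K * m K * (bigM m K * ‖dirichlet m (bigM m K) x t‖ₑ) := by ring
        _ ≤ b * b * majorant m K x t := by gcongr
        _ = _ := by ring
    have a2 : ‖∑ l ∈ Finset.range j, rho m K x t ^ l‖ₑ * ‖fejer m (bigM m K) x t‖ₑ ≤
        b ^ 2 * majorant m K x t := by
      calc _ ≤ (b : ℝ≥0∞) * (b * majorant m K x t) := by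
            gcongr
            · exact (enorm_sum_rho_pow_le _ _ _ _).trans hjb
            · exact enorm_fejer_bigM_le hm hb K x t
        _ = _ := by ring
    have a3 : (i : ℝ≥0∞) * ‖dirichlet m (j * bigM m K) x t‖ₑ ≤ b ^ 2 * majorant m K x t := by
      calc _ ≤ (bigM m K : ℝ≥0∞) * (b * ‖dirichlet m (bigM m K) x t‖ₑ) := by
            gcongr
            refine (enorm_dirichlet_mul_le hm hjm.le x t).trans ?_
            gcongr
        _ = b * (1 * (bigM m K * ‖dirichlet m (bigM m K) x t‖ₑ)) := by ring
        _ ≤ b * (b * majorant m K x t) := by gcongr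
        _ = _ := by ring
    calc _ ≤ b ^ 2 * majorant m K x t + b ^ 2 * majorant m K x t + b ^ 2 * majorant m K x t +
          3 * b ^ 2 * ∑ B ∈ Finset.range K, majorant m B x t := by
            gcongr
            exact ih hib
      _ = _ := by ring

end Vilenkin

/-! ### Fejér means of bounded functions and of atoms. -/

namespace Vilenkin

variable {m : ℕ → ℕ}

/-! ### Integrals of the majorant -/

theorem two_pow_mul_bigM_le (hm : ∀ k, 2 ≤ m k) (n d : ℕ) :
    2 ^ d * bigM m n ≤ bigM m (n + d) := by
  induction d with
  | zero => simp
  | succ d ih =>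
    calc 2 ^ (d + 1) * bigM m n = 2 * (2 ^ d * bigM m n) := by ring
      _ ≤ m (n + d) * bigM m (n + d) := Nat.mul_le_mul (hm _) ih

theorem sum_bigM_le (hm : ∀ k, 2 ≤ m k) (n : ℕ) :
    ∑ s ∈ Finset.range (n + 1), bigM m s ≤ 2 * bigM m n := by
  induction n with
  | zero => simp [bigM]
  | succ n ih =>
    rw [Finset.sum_range_succ]
    have := Nat.mul_le_mul_right (bigM m n) (hm n)
    have e : bigM m (n + 1) = m n * bigM m n := rfl
    omega

theorem sub_mul_bigM_le (hm : ∀ k, 2 ≤ m k) {n K : ℕ} (h : n ≤ K) :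
    (K - n) * bigM m n ≤ bigM m K := by
  obtain ⟨d, rfl⟩ := Nat.exists_eq_add_of_le h
  have h1 := two_pow_mul_bigM_le hm n d
  have h2 : d ≤ 2 ^ d := Nat.lt_two_pow_self.le
  rw [Nat.add_sub_cancel_left]
  exact (Nat.mul_le_mul_right _ h2).trans h1

theorem exists_bigM_le_lt (hm : ∀ k, 2 ≤ m k) {n : ℕ} (hn : 1 ≤ n) :
    ∃ K, bigM m K ≤ n ∧ n < bigM m (K + 1) := by
  have hex : ∃ K, n < bigM m K := ⟨n, lt_bigM m hm n⟩
  classical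
  obtain ⟨K, hK⟩ : ∃ K, Nat.find hex = K + 1 := by
    refine Nat.exists_eq_succ_of_ne_zero fun h0 => ?_
    have := Nat.find_spec hex
    rw [h0] at this
    simp [bigM] at this
    omega
  refine ⟨K, ?_, hK ▸ Nat.find_spec hex⟩
  exact not_lt.1 (Nat.find_min hex (hK ▸ Nat.lt_succ_self K))

variable [∀ k, NeZero (m k)]

theorem measurable_majorant (B : ℕ) (x : VilenkinGroup m) : Measurable (majorant m B x) :=
  Finset.measurable_sum _ fun s _ => measurable_const.indicator (measurableSet_near B s x)

/-- The `s`-th box has measure at most `b / M_B`, so its summand integrates to at most `b M_s`, and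
the `M_s` grow geometrically. -/
theorem lintegral_majorant_le (hm : ∀ k, 2 ≤ m k) {b : ℕ} (hb : ∀ k, m k ≤ b) (B : ℕ)
    (x : VilenkinGroup m) :
    ∫⁻ t, majorant m B x t ∂(haar m) ≤ 2 * b * bigM m B := by
  simp only [majorant]
  rw [lintegral_finsetSum _ fun s _ => measurable_const.indicator (measurableSet_near B s x)]
  calc _ ≤ ∑ s ∈ Finset.range (B + 1), (b * bigM m s : ℝ≥0∞) := by
        refine Finset.sum_le_sum fun s _ => ?_
        rw [lintegral_indicator_const (measurableSet_near B s x)]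
        calc _ ≤ (bigM m B * bigM m s : ℝ≥0∞) * (b * (bigM m B : ℝ≥0∞)⁻¹) := by
              gcongr; exact haar_near_le hb B s x
          _ = (bigM m B * (bigM m B : ℝ≥0∞)⁻¹) * (b * bigM m s) := by ring
          _ = _ := by
            rw [ENNReal.mul_inv_cancel (bigM_cast_ne_zero B) (bigM_cast_ne_top B), one_mul]
    _ = b * ((∑ s ∈ Finset.range (B + 1), bigM m s : ℕ) : ℝ≥0∞) := by
        rw [← Finset.mul_sum]; push_cast; rfl
    _ ≤ b * ((2 * bigM m B : ℕ) : ℝ≥0∞) := by gcongr; exact sum_bigM_le hm B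
    _ = _ := by push_cast; ring

/-- Convolution with the Fejér kernels is uniformly bounded on bounded functions. -/
theorem enorm_integral_mul_fejer_le (hm : ∀ k, 2 ≤ m k) {b : ℕ} (hb : ∀ k, m k ≤ b)
    {g : VilenkinGroup m → ℂ} {A : ℝ≥0∞} (hg : ∀ t, ‖g t‖ₑ ≤ A) (n : ℕ) (x : VilenkinGroup m) :
    ‖∫ t, g t * fejer m n x t ∂(haar m)‖ₑ ≤ n * (12 * b ^ 3 * A) := by
  rcases Nat.eq_zero_or_pos n with rfl | hn
  · simp [fejer]
  -- Ranks up to `K` suffice, and `∑_{B ≤ K} M_B ≤ 2 M_K ≤ 2 n`; the constant is `12 b³ = 3 b² · 2 b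
  -- · 2`.
  obtain ⟨K, hK1, hK2⟩ := exists_bigM_le_lt hm hn
  refine (enorm_integral_le_lintegral_enorm _).trans ?_
  calc ∫⁻ t, ‖g t * fejer m n x t‖ₑ ∂(haar m)
      ≤ ∫⁻ t, A * (3 * b ^ 2 * ∑ B ∈ Finset.range (K + 1), majorant m B x t) ∂(haar m) := by
        refine lintegral_mono fun t => ?_
        rw [enorm_mul]
        gcongr
        · exact hg t
        · exact enorm_fejer_le hm hb _ hK2 x t
    _ = A * (3 * b ^ 2 * ∑ B ∈ Finset.range (K + 1), ∫⁻ t, majorant m B x t ∂(haar m)) := by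
        have hs : Measurable fun t => ∑ B ∈ Finset.range (K + 1), majorant m B x t :=
          Finset.measurable_sum _ fun B _ => measurable_majorant B x
        rw [lintegral_const_mul _ (hs.const_mul _), lintegral_const_mul _ hs,
          lintegral_finsetSum _ fun B _ => measurable_majorant B x]
    _ ≤ A * (3 * b ^ 2 * ∑ B ∈ Finset.range (K + 1), (2 * b * bigM m B : ℝ≥0∞)) := by
        gcongr
        exact lintegral_majorant_le hm hb _ x
    _ = A * (6 * b ^ 3 * ((∑ B ∈ Finset.range (K + 1), bigM m B : ℕ) : ℝ≥0∞)) := by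
        rw [← Finset.mul_sum]; push_cast; ring
    _ ≤ A * (6 * b ^ 3 * ((2 * n : ℕ) : ℝ≥0∞)) := by
        gcongr
        exact (sum_bigM_le hm K).trans (by omega)
    _ = _ := by push_cast; ring

theorem setLIntegral_majorant_le_of_le {B n : ℕ} (h : B ≤ n) (x y : VilenkinGroup m) :
    ∫⁻ t in interval m n y, majorant m B x t ∂(haar m) ≤
      (bigM m n : ℝ≥0∞)⁻¹ * majorant m B x y := by
  have : ∀ t ∈ interval m n y, majorant m B x t = majorant m B x y := by
    intro t ht
    refine Finset.sum_congr rfl fun s _ => ?_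
    have := (firstCoords_mem_near B s x).mono h y t ht
    simp only [eq_iff_iff] at this
    by_cases h' : y ∈ near m B s x <;> simp [h', this]
  rw [setLIntegral_congr_fun (measurableSet_interval n y) this, setLIntegral_const, haar_interval,
    mul_comm]

/-- As `x` and `y` already differ below `n`, the exempt coordinate `s` must lie below `n`. Then `t`
is prescribed by `y` below `n` and by `x` from `n` to `B - 1`, which leaves measure at most `1 /
M_B` and cancels the factor `M_B`. Hence the bound does not depend on `B`. -/
theorem setLIntegral_majorant_le_of_ge {B n : ℕ} (h : n ≤ B) {x y : VilenkinGroup m}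
    (hx : x ∉ interval m n y) :
    ∫⁻ t in interval m n y, majorant m B x t ∂(haar m) ≤
      (bigM m n : ℝ≥0∞)⁻¹ * majorant m n x y := by
  simp only [majorant]
  rw [lintegral_finsetSum _ fun s _ => measurable_const.indicator (measurableSet_near B s x)]
  obtain ⟨d, rfl⟩ := Nat.exists_eq_add_of_le h
  rw [show n + d + 1 = n + 1 + d by ring, Finset.sum_range_add]
  have hfar : ∀ s, n ≤ s → ∀ t ∈ interval m n y, t ∉ near m (n + d) s x := by
    intro s hs t ht ht'
    refine hx fun i hi => ?_
    rw [← ht i hi, ht' i (by omega) (by omega)]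
  have hzero : ∑ j ∈ Finset.range d, ∫⁻ t in interval m n y,
      (near m (n + d) (n + 1 + j) x).indicator
        (fun _ => (bigM m (n + d) * bigM m (n + 1 + j) : ℝ≥0∞)) t ∂(haar m) = 0 := by
    refine Finset.sum_eq_zero fun j _ => ?_
    rw [setLIntegral_congr_fun (g := fun _ => 0) (measurableSet_interval n y) fun t ht =>
      Set.indicator_of_notMem (hfar _ (by omega) t ht) _]
    simp
  rw [hzero, add_zero, Finset.mul_sum]
  refine Finset.sum_le_sum fun s hs => ?_
  rw [lintegral_indicator_const (measurableSet_near _ _ _),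
    Measure.restrict_apply (measurableSet_near _ _ _)]
  by_cases hy : y ∈ near m n s x
  · have hsub : near m (n + d) s x ∩ interval m n y ⊆
        interval m (n + d) (fun i => if i < n then y i else x i) := by
      rintro t ⟨ht, ht'⟩ i hi
      by_cases hin : i < n
      · simp [hin, ht' i hin]
      · have hsn : s ≠ i := by
          rintro rfl
          exact hfar s (by omega) t ht' ht
        simp [hin, ht i hi hsn.symm]
    rw [Set.indicator_of_mem hy]
    calc _ ≤ (bigM m (n + d) * bigM m s : ℝ≥0∞) * (bigM m (n + d) : ℝ≥0∞)⁻¹ := by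
          gcongr
          exact (measure_mono hsub).trans (haar_interval _ _).le
      _ = (bigM m (n + d) * (bigM m (n + d) : ℝ≥0∞)⁻¹) * bigM m s := by ring
      _ = ((bigM m n : ℝ≥0∞)⁻¹ * bigM m n) * bigM m s := by
          rw [ENNReal.mul_inv_cancel (bigM_cast_ne_zero _) (bigM_cast_ne_top _),
            ENNReal.inv_mul_cancel (bigM_cast_ne_zero _) (bigM_cast_ne_top _)]
      _ = _ := by ring
  · have : near m (n + d) s x ∩ interval m n y = ∅ := by
      refine Set.eq_empty_of_forall_notMem fun t ht => hy fun i hi hs => ?_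
      rw [← ht.2 i hi, ht.1 i (by omega) hs]
    rw [this]
    simp

/-- The function that dominates the Fejér means of an atom away from its support. -/
noncomputable def tail (m : ℕ → ℕ) (n : ℕ) (y x : VilenkinGroup m) : ℝ≥0∞ :=
  ∑ B ∈ Finset.range (n + 1), majorant m B x y

omit [∀ k, NeZero (m k)] in
theorem majorant_comm (B : ℕ) (x y : VilenkinGroup m) : majorant m B x y = majorant m B y x := by
  refine Finset.sum_congr rfl fun s _ => ?_
  by_cases h : y ∈ near m B s x
  · rw [Set.indicator_of_mem h, Set.indicator_of_mem (near_comm.1 h)]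
  · rw [Set.indicator_of_notMem h, Set.indicator_of_notMem fun h' => h (near_comm.1 h')]

theorem measurable_tail (n : ℕ) (y : VilenkinGroup m) : Measurable (tail m n y) := by
  have : tail m n y = fun x => ∑ B ∈ Finset.range (n + 1), majorant m B y x := by
    funext x; exact Finset.sum_congr rfl fun B _ => majorant_comm B x y
  rw [this]
  exact Finset.measurable_sum _ fun B _ => measurable_majorant B y

theorem firstCoords_psiTwo (hm : ∀ k, 2 ≤ m k) {i K : ℕ} (h : i < bigM m K)
    (x : VilenkinGroup m) : FirstCoords m K (psiTwo m i x) :=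
  (firstCoords_psi hm h).comp fun z => psi m i x * (starRingEnd ℂ) z

theorem firstCoords_dirichlet (hm : ∀ k, 2 ≤ m k) {n K : ℕ} (h : n ≤ bigM m K)
    (x : VilenkinGroup m) : FirstCoords m K (dirichlet m n x) := by
  intro t u hu
  refine Finset.sum_congr rfl fun i hi => ?_
  exact firstCoords_psiTwo hm ((Finset.mem_range.1 hi).trans_le h) x t u hu

theorem firstCoords_fejer (hm : ∀ k, 2 ≤ m k) {n K : ℕ} (h : n ≤ bigM m K)
    (x : VilenkinGroup m) : FirstCoords m K (fejer m n x) := by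
  intro t u hu
  refine Finset.sum_congr rfl fun i hi => ?_
  exact firstCoords_dirichlet hm ((Finset.mem_range.1 hi).le.trans h) x t u hu

/-- The Fejér means of an atom away from its support. -/
theorem enorm_integral_atom_mul_fejer_le (hm : ∀ k, 2 ≤ m k) {b : ℕ} (hb : ∀ k, m k ≤ b)
    {n : ℕ} {y : VilenkinGroup m} {a : VilenkinGroup m → ℂ} {A : ℝ≥0∞}
    (hA : ∀ t, ‖a t‖ₑ ≤ A) (hsupp : ∀ t, t ∉ interval m n y → a t = 0)
    (hzero : ∫ t, a t ∂(haar m) = 0) (k : ℕ) {x : VilenkinGroup m} (hx : x ∉ interval m n y) :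
    ‖∫ t, a t * fejer m k x t ∂(haar m)‖ₑ ≤
      k * (6 * b ^ 2 * A * ((bigM m n : ℝ≥0∞)⁻¹ ^ 2) * tail m n y x) := by
  -- For `k ≤ M_n` the kernel is constant on the support of `a`, and the mean value zero kills the
  -- integral.
  rcases le_or_gt k (bigM m n) with hk | hk
  · have : ∀ t, a t * fejer m k x t = a t * fejer m k x y := by
      intro t
      by_cases ht : t ∈ interval m n y
      · rw [firstCoords_fejer hm hk x y t ht]
      · simp [hsupp t ht]
    simp [this, integral_mul_const, hzero]
  obtain ⟨K, hK1, hK2⟩ := exists_bigM_le_lt hm ((bigM_pos n).trans hk)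
  have hnK : n ≤ K := by
    by_contra! h
    exact absurd (hK2.trans_le (bigM_mono h)) (by omega)
  set μn : ℝ≥0∞ := (bigM m n : ℝ≥0∞)⁻¹ with hμn
  have hV : ∑ B ∈ Finset.range (K + 1), ∫⁻ t in interval m n y, majorant m B x t ∂(haar m) ≤
      μn * tail m n y x + (K - n : ℕ) * (μn * majorant m n x y) := by
    obtain ⟨d, rfl⟩ := Nat.exists_eq_add_of_le hnK
    rw [show n + d + 1 = n + 1 + d by ring, Finset.sum_range_add, tail, Finset.mul_sum,
      Nat.add_sub_cancel_left]
    gcongr with B hB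
    · exact setLIntegral_majorant_le_of_le (by have := Finset.mem_range.1 hB; omega) x y
    · calc _ ≤ ∑ j ∈ Finset.range d, μn * majorant m n x y :=
            Finset.sum_le_sum fun j _ => setLIntegral_majorant_le_of_ge (by omega) hx
        _ = _ := by simp
  have hVt : majorant m n x y ≤ tail m n y x := by
    rw [tail, Finset.sum_range_succ]; exact le_add_self
  have hμ1 : μn = bigM m n * μn ^ 2 := by
    rw [sq, ← mul_assoc, ENNReal.mul_inv_cancel (bigM_cast_ne_zero _) (bigM_cast_ne_top _), one_mul]
  -- The `K - n` ranks above `n` all contribute the same amount; `(K - n) M_n ≤ M_K ≤ k` absorbs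
  -- their number and also gains the second factor `M_n⁻¹`.
  have hfin : μn * tail m n y x + (K - n : ℕ) * (μn * majorant m n x y) ≤
      k * (2 * μn ^ 2 * tail m n y x) := by
    have h1 : μn * tail m n y x ≤ k * (μn ^ 2 * tail m n y x) := by
      calc μn * tail m n y x = bigM m n * (μn ^ 2 * tail m n y x) := by
            conv_lhs => rw [hμ1]
            ring
        _ ≤ _ := by gcongr
    have h2 : ((K - n : ℕ) : ℝ≥0∞) * (μn * majorant m n x y) ≤ k * (μn ^ 2 * tail m n y x) := by
      calc ((K - n : ℕ) : ℝ≥0∞) * (μn * majorant m n x y)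
          = (((K - n) * bigM m n : ℕ) : ℝ≥0∞) * (μn ^ 2 * majorant m n x y) := by
            conv_lhs => rw [hμ1]
            push_cast; ring
        _ ≤ k * (μn ^ 2 * tail m n y x) := by
            gcongr
            exact (sub_mul_bigM_le hm hnK).trans hK1
    calc _ ≤ k * (μn ^ 2 * tail m n y x) + k * (μn ^ 2 * tail m n y x) := add_le_add h1 h2
      _ = _ := by ring
  have hs : Measurable fun t => ∑ B ∈ Finset.range (K + 1), majorant m B x t :=
    Finset.measurable_sum _ fun B _ => measurable_majorant B x
  calc ‖∫ t, a t * fejer m k x t ∂(haar m)‖ₑ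
      = ‖∫ t in interval m n y, a t * fejer m k x t ∂(haar m)‖ₑ := by
        rw [setIntegral_eq_integral_of_forall_compl_eq_zero fun t ht => by simp [hsupp t ht]]
    _ ≤ ∫⁻ t in interval m n y, ‖a t * fejer m k x t‖ₑ ∂(haar m) :=
        enorm_integral_le_lintegral_enorm _
    _ ≤ ∫⁻ t in interval m n y,
          A * (3 * b ^ 2 * ∑ B ∈ Finset.range (K + 1), majorant m B x t) ∂(haar m) := by
        refine lintegral_mono fun t => ?_
        rw [enorm_mul]
        gcongr
        · exact hA t
        · exact enorm_fejer_le hm hb _ hK2 x t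
    _ = A * (3 * b ^ 2 * ∑ B ∈ Finset.range (K + 1),
          ∫⁻ t in interval m n y, majorant m B x t ∂(haar m)) := by
        rw [lintegral_const_mul _ (hs.const_mul _), lintegral_const_mul _ hs,
          lintegral_finsetSum _ fun B _ => measurable_majorant B x]
    _ ≤ A * (3 * b ^ 2 * (k * (2 * μn ^ 2 * tail m n y x))) := by
        gcongr
        exact hV.trans hfin
    _ = _ := by ring

end Vilenkin

/-! ### Weak type 1/2 for series and for the tails of atoms. -/

namespace Vilenkin

/-! ### Sums of functions of weak type -/

theorem rpow_sum_le_sum_rpow {ι : Type*} (s : Finset ι) (f : ι → ℝ≥0∞) {p : ℝ} (hp : 0 < p)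
    (hp1 : p ≤ 1) : (∑ i ∈ s, f i) ^ p ≤ ∑ i ∈ s, f i ^ p := by
  classical
  induction s using Finset.induction_on with
  | empty => simp [hp]
  | insert i s hi ih =>
    rw [Finset.sum_insert hi, Finset.sum_insert hi]
    exact (ENNReal.rpow_add_le_add_rpow _ _ hp.le hp1).trans (by gcongr)

theorem rpow_tsum_le_tsum_rpow {ι : Type*} (f : ι → ℝ≥0∞) {p : ℝ} (hp : 0 < p)
    (hp1 : p ≤ 1) : (∑' i, f i) ^ p ≤ ∑' i, f i ^ p := by
  rw [ENNReal.tsum_eq_iSup_sum]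
  have := (ENNReal.orderIsoRpow p hp).map_iSup fun s : Finset ι => ∑ i ∈ s, f i
  simp only [ENNReal.orderIsoRpow_apply] at this
  rw [this]
  exact iSup_le fun s => (rpow_sum_le_sum_rpow s f hp hp1).trans (ENNReal.sum_le_tsum s)

/-- Weak-`L_{1/2}` functions can be summed with coefficients in `ℓ^{1/2}`. The hypothesis `h`
encodes weak type: `r²` plays the role of the height at which `g j` is truncated. Off the union of
the exceptional sets the power `3/4` is subadditive, being at most `1`, and integrable, exceeding
`1/2`; Markov's inequality finishes. -/
theorem measure_le_tsum_le {Ω ι : Type*} [MeasurableSpace Ω] {μ : Measure Ω} [Countable ι]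
    {C : ℝ≥0∞} {g : ι → Ω → ℝ≥0∞} (hg : ∀ j, Measurable (g j))
    (h : ∀ j, ∀ r : ℝ≥0, 0 < r → ∃ E, MeasurableSet E ∧ μ E ≤ C * (r⁻¹ : ℝ≥0) ∧
      ∫⁻ x in Eᶜ, g j x ^ (3 / 4 : ℝ) ∂μ ≤ C * (r ^ (1 / 2 : ℝ) : ℝ≥0))
    (c : ι → ℝ≥0) {l : ℝ≥0} (hl : 0 < l) :
    μ {x | (l : ℝ≥0∞) ≤ ∑' j, c j * g j x} ≤
      2 * C * (∑' j, ((c j ^ (1 / 2 : ℝ) : ℝ≥0) : ℝ≥0∞)) * ((l⁻¹) ^ (1 / 2 : ℝ) : ℝ≥0) := by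
  set w : ι → ℝ≥0 := fun j => c j ^ (1 / 2 : ℝ) * (l⁻¹) ^ (1 / 2 : ℝ) with hw
  have hE : ∀ j, ∃ E, MeasurableSet E ∧ μ E ≤ C * w j ∧
      ∫⁻ x in Eᶜ, (c j * g j x) ^ (3 / 4 : ℝ) ∂μ ≤ C * w j * (l ^ (3 / 4 : ℝ) : ℝ≥0) := by
    intro j
    rcases eq_or_ne (c j) 0 with hc | hc
    · refine ⟨∅, MeasurableSet.empty, by simp, ?_⟩
      simp [hc]
    -- With `r² = l / c_j` the function `c_j g_j` is cut at height `l`, and both bounds become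
    -- multiples of `w j = (c_j / l)^{1/2}`.
    obtain ⟨E, hE, h1, h2⟩ := h j ((l / c j) ^ (1 / 2 : ℝ)) (by positivity)
    refine ⟨E, hE, h1.trans (le_of_eq ?_), ?_⟩
    · congr 2
      simp only [hw]
      rw [← NNReal.mul_rpow, ← NNReal.inv_rpow, inv_div, div_eq_mul_inv]
    · simp_rw [ENNReal.mul_rpow_of_nonneg _ _ (show (0 : ℝ) ≤ 3 / 4 by norm_num)]
      rw [lintegral_const_mul _ ((hg j).pow_const _)]
      refine (mul_le_mul_right h2 _).trans (le_of_eq ?_)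
      rw [← ENNReal.coe_rpow_of_nonneg _ (show (0 : ℝ) ≤ 3 / 4 by norm_num), mul_left_comm,
        mul_assoc, ← ENNReal.coe_mul, ← ENNReal.coe_mul]
      congr 2
      simp only [hw]
      rw [← NNReal.rpow_mul, NNReal.div_rpow, NNReal.inv_rpow]
      have e1 : c j ^ (3 / 4 : ℝ) = c j ^ (1 / 2 : ℝ) * c j ^ (1 / 2 * (1 / 2) : ℝ) := by
        rw [← NNReal.rpow_add hc]; norm_num
      have e2 : l ^ (3 / 4 : ℝ) = l ^ (1 / 2 : ℝ) * l ^ (1 / 2 * (1 / 2) : ℝ) := by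
        rw [← NNReal.rpow_add hl.ne']; norm_num
      have n1 : c j ^ (1 / 2 * (1 / 2) : ℝ) ≠ 0 := by positivity
      have n2 : l ^ (1 / 2 : ℝ) ≠ 0 := by positivity
      rw [e1, e2]
      field_simp
  choose E hEm hE1 hE2 using hE
  have hsub : {x | (l : ℝ≥0∞) ≤ ∑' j, c j * g j x} ⊆ (⋃ j, E j) ∪
      {x | ((l ^ (3 / 4 : ℝ) : ℝ≥0) : ℝ≥0∞) ≤
        ∑' j, (E j)ᶜ.indicator (fun x => (c j * g j x) ^ (3 / 4 : ℝ)) x} := by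
    intro x hx
    by_cases hxE : x ∈ ⋃ j, E j
    · exact Or.inl hxE
    · right
      have hxE' : ∀ j, x ∈ (E j)ᶜ := fun j hj => hxE (Set.mem_iUnion.2 ⟨j, hj⟩)
      simp only [Set.mem_ofPred_eq, Set.indicator_of_mem (hxE' _)]
      rw [ENNReal.coe_rpow_of_nonneg _ (by norm_num)]
      exact (ENNReal.rpow_le_rpow hx (by norm_num)).trans
        (rpow_tsum_le_tsum_rpow _ (by norm_num) (by norm_num))
  have hl' : ((l ^ (3 / 4 : ℝ) : ℝ≥0) : ℝ≥0∞) ≠ 0 := by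
    have : l ^ (3 / 4 : ℝ) ≠ 0 := by positivity
    exact_mod_cast this
  have hmeas : ∀ j, Measurable ((E j)ᶜ.indicator fun x => (c j * g j x) ^ (3 / 4 : ℝ)) :=
    fun j => (((hg j).const_mul _).pow_const _).indicator (hEm j).compl
  have h1 : μ (⋃ j, E j) ≤ C * ∑' j, (w j : ℝ≥0∞) := by
    rw [← ENNReal.tsum_mul_left]
    exact (measure_iUnion_le _).trans (ENNReal.tsum_le_tsum hE1)
  have h2 : μ {x | ((l ^ (3 / 4 : ℝ) : ℝ≥0) : ℝ≥0∞) ≤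
      ∑' j, (E j)ᶜ.indicator (fun x => (c j * g j x) ^ (3 / 4 : ℝ)) x} ≤
        C * ∑' j, (w j : ℝ≥0∞) := by
    refine (meas_ge_le_lintegral_div (Measurable.tsum hmeas).aemeasurable hl'
      ENNReal.coe_ne_top).trans (ENNReal.div_le_of_le_mul ?_)
    rw [lintegral_tsum fun j => (hmeas j).aemeasurable, ← ENNReal.tsum_mul_left,
      ← ENNReal.tsum_mul_right]
    refine ENNReal.tsum_le_tsum fun j => ?_
    rw [lintegral_indicator (hEm j).compl]
    exact hE2 j
  refine (measure_mono hsub).trans ((measure_union_le _ _).trans ((add_le_add h1 h2).trans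
    (le_of_eq ?_)))
  simp only [hw, ENNReal.coe_mul, ENNReal.tsum_mul_right]
  ring

variable {m : ℕ → ℕ}

/-- The induction closes because `4 √M_K ≤ 3 √(2 M_K) ≤ 3 √M_{K+1}`, that is, `16 ≤ 18`. -/
theorem sum_sqrt_bigM_le (hm : ∀ k, 2 ≤ m k) (K : ℕ) :
    ∑ s ∈ Finset.range K, (bigM m s : ℝ≥0∞) ^ (1 / 2 : ℝ) ≤
      3 * (bigM m K : ℝ≥0∞) ^ (1 / 2 : ℝ) := by
  induction K with
  | zero => simp
  | succ K ih =>
    rw [Finset.sum_range_succ]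
    have hsq : ∀ a x : ℝ≥0∞, a * x ^ (1 / 2 : ℝ) = (a ^ 2 * x) ^ (1 / 2 : ℝ) := by
      intro a x
      rw [ENNReal.mul_rpow_of_nonneg _ _ (by norm_num), ← ENNReal.rpow_two, ← ENNReal.rpow_mul]
      norm_num
    calc _ ≤ 3 * (bigM m K : ℝ≥0∞) ^ (1 / 2 : ℝ) + (bigM m K : ℝ≥0∞) ^ (1 / 2 : ℝ) := by gcongr
      _ = 4 * (bigM m K : ℝ≥0∞) ^ (1 / 2 : ℝ) := by ring
      _ = ((16 * bigM m K : ℕ) : ℝ≥0∞) ^ (1 / 2 : ℝ) := by rw [hsq]; push_cast; norm_num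
      _ ≤ ((9 * bigM m (K + 1) : ℕ) : ℝ≥0∞) ^ (1 / 2 : ℝ) := by
        refine ENNReal.rpow_le_rpow (Nat.cast_le.2 ?_) (by norm_num)
        have h2 : 2 * bigM m K ≤ bigM m (K + 1) := Nat.mul_le_mul_right (bigM m K) (hm K)
        omega
      _ = _ := by rw [hsq]; push_cast; norm_num

variable [∀ k, NeZero (m k)]

omit [∀ k, NeZero (m k)] in
theorem sum_rpow_neg_bigM_le (hm : ∀ k, 2 ≤ m k) (s d : ℕ) :
    ∑ j ∈ Finset.range d, (bigM m (s + j) : ℝ≥0∞) ^ (-(1 / 4) : ℝ) ≤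
      (1 - 2 ^ (-(1 / 4) : ℝ))⁻¹ * (bigM m s : ℝ≥0∞) ^ (-(1 / 4) : ℝ) := by
  calc _ ≤ ∑ j ∈ Finset.range d, (2 ^ (-(1 / 4) : ℝ)) ^ j *
          (bigM m s : ℝ≥0∞) ^ (-(1 / 4) : ℝ) := by
        refine Finset.sum_le_sum fun j _ => ?_
        rw [← ENNReal.rpow_natCast, ← ENNReal.rpow_mul, mul_comm (-(1 / 4) : ℝ),
          ENNReal.rpow_mul, ENNReal.rpow_natCast,
          ← ENNReal.mul_rpow_of_ne_top (by simp) (by simp),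
          ENNReal.rpow_neg, ENNReal.rpow_neg]
        gcongr
        exact_mod_cast two_pow_mul_bigM_le hm s j
    _ = (∑ j ∈ Finset.range d, (2 ^ (-(1 / 4) : ℝ)) ^ j) *
          (bigM m s : ℝ≥0∞) ^ (-(1 / 4) : ℝ) := by rw [Finset.sum_mul]
    _ ≤ _ := by
        gcongr
        rw [← ENNReal.tsum_geometric]
        exact ENNReal.sum_le_tsum _

/-- The constant in the weak-type estimate for `tail`. -/
noncomputable def tailConst (b : ℕ) : ℝ≥0∞ := 3 * b * (1 - 2 ^ (-(1 / 4) : ℝ))⁻¹ + b + 1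

theorem tailConst_ne_top (b : ℕ) : tailConst b ≠ ∞ := by
  have h : (2 : ℝ≥0∞) ^ (-(1 / 4) : ℝ) < 1 :=
    ENNReal.rpow_lt_one_of_one_lt_of_neg (by norm_num) (by norm_num)
  have : (1 - (2 : ℝ≥0∞) ^ (-(1 / 4) : ℝ))⁻¹ ≠ ∞ := ENNReal.inv_ne_top.2 (tsub_pos_of_lt h).ne'
  unfold tailConst
  finiteness

theorem lintegral_near_rpow_le {b : ℕ} (hb : ∀ k, m k ≤ b) (B s : ℕ) (y : VilenkinGroup m) :
    ∫⁻ x, ((near m B s y).indicator (fun _ => (bigM m B * bigM m s : ℝ≥0∞)) x) ^ (3 / 4 : ℝ)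
      ∂(haar m) ≤ b * (bigM m s : ℝ≥0∞) ^ (3 / 4 : ℝ) * (bigM m B : ℝ≥0∞) ^ (-(1 / 4) : ℝ) := by
  have : ∀ x, ((near m B s y).indicator (fun _ => (bigM m B * bigM m s : ℝ≥0∞)) x) ^ (3 / 4 : ℝ) =
      (near m B s y).indicator (fun _ => (bigM m B * bigM m s : ℝ≥0∞) ^ (3 / 4 : ℝ)) x := by
    intro x
    by_cases h : x ∈ near m B s y <;> simp [h]
  simp only [this]
  rw [lintegral_indicator_const (measurableSet_near _ _ _),
    ENNReal.mul_rpow_of_nonneg _ _ (by norm_num)]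
  calc _ ≤ (bigM m B : ℝ≥0∞) ^ (3 / 4 : ℝ) * (bigM m s : ℝ≥0∞) ^ (3 / 4 : ℝ) *
        (b * (bigM m B : ℝ≥0∞) ^ (-1 : ℝ)) := by
        rw [ENNReal.rpow_neg_one]
        gcongr
        exact haar_near_le hb B s y
    _ = b * (bigM m s : ℝ≥0∞) ^ (3 / 4 : ℝ) *
        ((bigM m B : ℝ≥0∞) ^ (3 / 4 : ℝ) * (bigM m B : ℝ≥0∞) ^ (-1 : ℝ)) := by ring
    _ = _ := by
        rw [← ENNReal.rpow_add _ _ (bigM_cast_ne_zero B) (bigM_cast_ne_top B)]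
        norm_num

/-- Off `I_K(y)` the boxes with `K ≤ s ≤ B` are empty, since they lie inside `I_K(y)`. For fixed `s
< K` the sum over `B ≥ s` of `M_s^{3/4} M_B^{-1/4}` is comparable to `M_s^{1/2}`, and the sum over
`s < K` to `M_K^{1/2}`, uniformly in `n`. -/
theorem lintegral_tail_rpow_le (hm : ∀ k, 2 ≤ m k) {b : ℕ} (hb : ∀ k, m k ≤ b) (n K : ℕ)
    (y : VilenkinGroup m) :
    ∫⁻ x in (interval m K y)ᶜ, tail m n y x ^ (3 / 4 : ℝ) ∂(haar m) ≤
      3 * b * (1 - 2 ^ (-(1 / 4) : ℝ))⁻¹ * (bigM m K : ℝ≥0∞) ^ (1 / 2 : ℝ) := by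
  set F : ℕ → ℕ → VilenkinGroup m → ℝ≥0∞ := fun B s x =>
    ((near m B s y).indicator (fun _ => (bigM m B * bigM m s : ℝ≥0∞)) x) ^ (3 / 4 : ℝ) with hF
  have hFm : ∀ B s, Measurable (F B s) := fun B s =>
    (measurable_const.indicator (measurableSet_near B s y)).pow_const _
  have hpt : ∀ x ∈ (interval m K y)ᶜ, tail m n y x ^ (3 / 4 : ℝ) ≤
      ∑ s ∈ Finset.range K, ∑ B ∈ Finset.Ico s (n + 1), F B s x := by
    intro x hx
    have h1 : tail m n y x ^ (3 / 4 : ℝ) ≤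
        ∑ B ∈ Finset.range (n + 1), ∑ s ∈ Finset.range (B + 1), F B s x := by
      refine (rpow_sum_le_sum_rpow _ _ (by norm_num) (by norm_num)).trans
        (Finset.sum_le_sum fun B _ => ?_)
      rw [majorant_comm]
      exact rpow_sum_le_sum_rpow _ _ (by norm_num) (by norm_num)
    refine h1.trans ?_
    rw [Finset.sum_comm' (t' := Finset.range (n + 1)) (s' := fun s => Finset.Ico s (n + 1))]
    · rcases le_total (n + 1) K with hK | hK
      · exact Finset.sum_le_sum_of_subset (Finset.range_mono hK)
      · rw [← Finset.sum_range_add_sum_Ico _ hK]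
        refine (add_le_add_right (Finset.sum_nonpos fun s hs =>
          Finset.sum_nonpos fun B hB => ?_) _).trans (add_zero _).le
        have : x ∉ near m B s y := by
          intro h
          refine hx fun i hi => ?_
          have := (Finset.mem_Ico.1 hs).1
          have := (Finset.mem_Ico.1 hB).1
          exact h i (by omega) (by omega)
        simp [hF, this]
    · intro B s
      simp only [Finset.mem_range, Finset.mem_Ico]
      omega
  calc _ ≤ ∫⁻ x in (interval m K y)ᶜ,
        ∑ s ∈ Finset.range K, ∑ B ∈ Finset.Ico s (n + 1), F B s x ∂(haar m) :=
        setLIntegral_mono' (measurableSet_interval K y).compl hpt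
    _ ≤ ∫⁻ x, ∑ s ∈ Finset.range K, ∑ B ∈ Finset.Ico s (n + 1), F B s x ∂(haar m) :=
        setLIntegral_le_lintegral _ _
    _ = ∑ s ∈ Finset.range K, ∑ B ∈ Finset.Ico s (n + 1), ∫⁻ x, F B s x ∂(haar m) := by
        rw [lintegral_finsetSum _ fun s _ => Finset.measurable_sum _ fun B _ => hFm B s]
        exact Finset.sum_congr rfl fun s _ => lintegral_finsetSum _ fun B _ => hFm B s
    _ ≤ ∑ s ∈ Finset.range K, ∑ B ∈ Finset.Ico s (n + 1),
          b * (bigM m s : ℝ≥0∞) ^ (3 / 4 : ℝ) * (bigM m B : ℝ≥0∞) ^ (-(1 / 4) : ℝ) := by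
        gcongr
        exact lintegral_near_rpow_le hb _ _ y
    _ ≤ ∑ s ∈ Finset.range K, b * (1 - 2 ^ (-(1 / 4) : ℝ))⁻¹ * (bigM m s : ℝ≥0∞) ^ (1 / 2 : ℝ) := by
        refine Finset.sum_le_sum fun s _ => ?_
        rw [← Finset.mul_sum, Finset.sum_Ico_eq_sum_range]
        calc _ ≤ b * (bigM m s : ℝ≥0∞) ^ (3 / 4 : ℝ) *
              ((1 - 2 ^ (-(1 / 4) : ℝ))⁻¹ * (bigM m s : ℝ≥0∞) ^ (-(1 / 4) : ℝ)) := by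
              gcongr
              exact sum_rpow_neg_bigM_le hm s _
          _ = b * (1 - 2 ^ (-(1 / 4) : ℝ))⁻¹ * ((bigM m s : ℝ≥0∞) ^ (3 / 4 : ℝ) *
              (bigM m s : ℝ≥0∞) ^ (-(1 / 4) : ℝ)) := by ring
          _ = _ := by
              rw [← ENNReal.rpow_add _ _ (bigM_cast_ne_zero s) (bigM_cast_ne_top s)]
              norm_num
    _ = b * (1 - 2 ^ (-(1 / 4) : ℝ))⁻¹ *
          ∑ s ∈ Finset.range K, (bigM m s : ℝ≥0∞) ^ (1 / 2 : ℝ) := by rw [Finset.mul_sum]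
    _ ≤ b * (1 - 2 ^ (-(1 / 4) : ℝ))⁻¹ * (3 * (bigM m K : ℝ≥0∞) ^ (1 / 2 : ℝ)) := by
        gcongr; exact sum_sqrt_bigM_le hm K
    _ = _ := by ring

/-- For `r ≥ 1` the exceptional set is the interval around `y` whose rank satisfies `M_K ≤ r ≤ b
M_K`; for `r < 1` it is the whole group, which accounts for the `1` in `tailConst`. -/
theorem exists_tail_exceptional (hm : ∀ k, 2 ≤ m k) {b : ℕ} (hb : ∀ k, m k ≤ b) (n : ℕ)
    (y : VilenkinGroup m) (r : ℝ≥0) (hr : 0 < r) :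
    ∃ E, MeasurableSet E ∧ haar m E ≤ tailConst b * (r⁻¹ : ℝ≥0) ∧
      ∫⁻ x in Eᶜ, tail m n y x ^ (3 / 4 : ℝ) ∂(haar m) ≤
        tailConst b * (r ^ (1 / 2 : ℝ) : ℝ≥0) := by
  rcases lt_or_ge r 1 with h1 | h1
  · refine ⟨Set.univ, MeasurableSet.univ, ?_, by simp⟩
    rw [measure_univ]
    have : (1 : ℝ≥0∞) ≤ (r⁻¹ : ℝ≥0) := by exact_mod_cast (one_le_inv₀ hr).2 h1.le
    calc (1 : ℝ≥0∞) = 1 * 1 := by simp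
      _ ≤ _ := by gcongr; exact le_add_self
  · obtain ⟨K, hK1, hK2⟩ := exists_bigM_le_lt hm (n := ⌊r⌋₊) (Nat.one_le_floor_iff _ |>.2 h1)
    have hKr : (bigM m K : ℝ≥0∞) ≤ r := by
      exact_mod_cast (Nat.cast_le.2 hK1).trans (Nat.floor_le hr.le)
    have hrK : r ≤ b * bigM m K := by
      have h2 : r < bigM m (K + 1) := (Nat.floor_lt hr.le).1 hK2
      refine h2.le.trans ?_
      have := Nat.mul_le_mul_right (bigM m K) (hb K)
      rw [bigM]
      exact_mod_cast this
    refine ⟨interval m K y, measurableSet_interval K y, ?_, ?_⟩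
    · rw [haar_interval]
      calc (bigM m K : ℝ≥0∞)⁻¹ ≤ b * (r⁻¹ : ℝ≥0) := by
            rw [ENNReal.inv_le_iff_inv_le, ENNReal.coe_inv hr.ne', ENNReal.mul_inv, inv_inv]
            · rw [mul_comm, ← div_eq_mul_inv]
              refine ENNReal.div_le_of_le_mul ?_
              rw [mul_comm]
              exact_mod_cast hrK
            · right; simp [hr.ne']
            · left; simp
        _ ≤ _ := by
            gcongr
            rw [tailConst, add_assoc]
            exact le_add_left le_self_add
    · refine (lintegral_tail_rpow_le hm hb n K y).trans ?_
      rw [ENNReal.coe_rpow_of_nonneg _ (by norm_num)]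
      gcongr
      rw [tailConst, add_assoc]
      exact le_self_add

end Vilenkin

/-! ### Reduction to finite levels, and the decomposition by stopping times. -/

namespace Vilenkin

variable {m : ℕ → ℕ} [∀ k, NeZero (m k)]

/-! ### Fourier coefficients and partial sums of martingales -/

omit [∀ k, NeZero (m k)] in
theorem firstCoords_of_martingale {f : ℕ → VilenkinGroup m → ℂ}
    (hf : Martingale f (filtration m) (haar m)) (n : ℕ) : FirstCoords m n (f n) :=
  firstCoords_of_measurable (hf.stronglyAdapted n).measurable

theorem setIntegral_martingale {f : ℕ → VilenkinGroup m → ℂ}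
    (hf : Martingale f (filtration m) (haar m)) {n k : ℕ} (h : n ≤ k) {s : Set (VilenkinGroup m)}
    (hs : FirstCoords m n (· ∈ s)) :
    ∫ x in s, (f k x - f n x) ∂(haar m) = 0 := by
  rw [integral_sub (firstCoords_of_martingale hf k).integrable.integrableOn
    (firstCoords_of_martingale hf n).integrable.integrableOn,
    hf.setIntegral_eq h hs.measurableSet, sub_self]

/-- The differences `f^{(k)} - f^{(N)}` are orthogonal to `ψ_i`, so the integrals are eventually
constant and `limUnder` is a genuine limit. -/
theorem fourierCoeff_eq (hm : ∀ k, 2 ≤ m k) {f : ℕ → VilenkinGroup m → ℂ}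
    (hf : Martingale f (filtration m) (haar m)) {i N : ℕ} (hi : i < bigM m N) :
    fourierCoeff m f i = ∫ x, f N x * (starRingEnd ℂ) (psi m i x) ∂(haar m) := by
  have hψ : FirstCoords m N fun x => (starRingEnd ℂ) (psi m i x) := (firstCoords_psi hm hi).comp _
  refine Tendsto.limUnder_eq (tendsto_const_nhds.congr' ?_)
  filter_upwards [eventually_ge_atTop N] with k hk
  have hfk := firstCoords_of_martingale hf k
  have hfN := firstCoords_of_martingale hf N
  have h := integral_mul_eq_zero (n := N) (u := fun x => f k x - f N x)
    (hfk.integrable.sub hfN.integrable) hψ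
    fun y => setIntegral_martingale hf hk (firstCoords_mem_interval le_rfl y)
  simp only [sub_mul] at h
  rw [integral_sub (hfk.comp₂ (hψ.mono hk) (· * ·)).integrable
    (hfN.comp₂ hψ (· * ·)).integrable] at h
  exact (sub_eq_zero.1 h).symm

theorem partialSum_eq_integral (hm : ∀ k, 2 ≤ m k) {f : ℕ → VilenkinGroup m → ℂ}
    (hf : Martingale f (filtration m) (haar m)) {n N : ℕ} (hn : n ≤ bigM m N)
    (x : VilenkinGroup m) :
    partialSum m f n x = ∫ t, f N t * dirichlet m n x t ∂(haar m) := by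
  simp only [dirichlet, Finset.mul_sum]
  rw [integral_finsetSum]
  · refine Finset.sum_congr rfl fun i hi => ?_
    rw [fourierCoeff_eq hm hf ((Finset.mem_range.1 hi).trans_le hn), ← integral_mul_const]
    congr 1
    funext t
    rw [psiTwo]
    ring
  · intro i hi
    exact ((firstCoords_of_martingale hf N).comp₂
      (firstCoords_psiTwo hm ((Finset.mem_range.1 hi).trans_le hn) x) (· * ·)).integrable

theorem sum_partialSum_eq_integral (hm : ∀ k, 2 ≤ m k) {f : ℕ → VilenkinGroup m → ℂ}
    (hf : Martingale f (filtration m) (haar m)) {n N : ℕ} (hn : n ≤ bigM m N)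
    (x : VilenkinGroup m) :
    ∑ k ∈ Finset.range n, partialSum m f k x = ∫ t, f N t * fejer m n x t ∂(haar m) := by
  simp only [fejer, Finset.mul_sum]
  rw [integral_finsetSum]
  · exact Finset.sum_congr rfl fun k hk =>
      partialSum_eq_integral hm hf ((Finset.mem_range.1 hk).le.trans hn) x
  · intro k hk
    exact ((firstCoords_of_martingale hf N).comp₂
      (firstCoords_dirichlet hm ((Finset.mem_range.1 hk).le.trans hn) x) (· * ·)).integrable

/-! ### Stopped martingales -/

/-- The points near which the martingale exceeds the level `l` at some time `1, …, n`; the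
definition looks one step ahead, so that this set is known at time `n - 1`. -/
def exceed (m : ℕ → ℕ) (f : ℕ → VilenkinGroup m → ℂ) (l : ℝ≥0∞) (n : ℕ) :
    Set (VilenkinGroup m) :=
  {x | ∃ j < n, ∃ y ∈ interval m j x, l < ‖f (j + 1) y‖ₑ}

open Classical in
/-- The martingale stopped before it exceeds the level `l`. -/
noncomputable def stopped (m : ℕ → ℕ) (f : ℕ → VilenkinGroup m → ℂ) (l : ℝ≥0∞) :
    ℕ → VilenkinGroup m → ℂ
  | 0 => f 0
  | n + 1 => fun x => if x ∈ exceed m f l (n + 1) then stopped m f l n x else f (n + 1) x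

variable {f : ℕ → VilenkinGroup m → ℂ} {l : ℝ≥0∞}

omit [∀ k, NeZero (m k)] in
open Classical in
theorem stopped_succ (n : ℕ) (x : VilenkinGroup m) : stopped m f l (n + 1) x =
    if x ∈ exceed m f l (n + 1) then stopped m f l n x else f (n + 1) x := rfl

omit [∀ k, NeZero (m k)] in
theorem exceed_mono {n k : ℕ} (h : n ≤ k) : exceed m f l n ⊆ exceed m f l k :=
  fun _ ⟨j, hj, hy⟩ => ⟨j, hj.trans_le h, hy⟩

omit [∀ k, NeZero (m k)] in
theorem exceed_anti {l' : ℝ≥0∞} (h : l ≤ l') (n : ℕ) : exceed m f l' n ⊆ exceed m f l n :=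
  fun _ ⟨j, hj, y, hy, hl⟩ => ⟨j, hj, y, hy, h.trans_lt hl⟩

omit [∀ k, NeZero (m k)] in
theorem firstCoords_exceed {n k : ℕ} (h : k ≤ n + 1) : FirstCoords m n (· ∈ exceed m f l k) := by
  intro x z hz
  refine propext ⟨fun ⟨j, hj, y, hy, hl⟩ => ⟨j, hj, y, ?_, hl⟩,
    fun ⟨j, hj, y, hy, hl⟩ => ⟨j, hj, y, ?_, hl⟩⟩
  · exact mem_interval_trans (interval_anti (by omega) _ hz) hy
  · exact mem_interval_trans (interval_anti (by omega) _ (mem_interval_comm.1 hz)) hy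

omit [∀ k, NeZero (m k)] in
-- Looking one step ahead stops the martingale before the jump, so there is no overshoot. The price
-- is the factor `b` in `inv_bigM_le_measure`.
theorem enorm_stopped_le (h0 : ∀ x, ‖f 0 x‖ₑ ≤ l) (n : ℕ) (x : VilenkinGroup m) :
    ‖stopped m f l n x‖ₑ ≤ l := by
  induction n with
  | zero => exact h0 x
  | succ n ih =>
    rw [stopped_succ]
    split_ifs with h
    · exact ih
    · exact not_lt.1 fun hl => h ⟨n, n.lt_succ_self, x, mem_interval_self n x, hl⟩

omit [∀ k, NeZero (m k)] in
theorem stopped_eq {n : ℕ} {x : VilenkinGroup m} (h : x ∉ exceed m f l n) :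
    stopped m f l n x = f n x := by
  cases n with
  | zero => rfl
  | succ n => rw [stopped_succ, if_neg h]

omit [∀ k, NeZero (m k)] in
theorem firstCoords_stopped (hf : Martingale f (filtration m) (haar m)) (n : ℕ) :
    FirstCoords m n (stopped m f l n) := by
  classical
  induction n with
  | zero => exact firstCoords_of_martingale hf 0
  | succ n ih =>
    intro x y h
    have h1 := firstCoords_exceed (f := f) (l := l) (Nat.le_succ (n + 1)) x y h
    simp only [eq_iff_iff] at h1
    rw [stopped_succ, stopped_succ, firstCoords_of_martingale hf (n + 1) x y h,
      ih.mono n.le_succ x y h]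
    exact if_congr h1 rfl rfl

/-- An increment of the stopped sequence is the increment of `f` restricted to the complement of
`exceed m f l (N + 1)`, a set known at time `N`; so stopping keeps the martingale property. -/
theorem setIntegral_stopped (hf : Martingale f (filtration m) (haar m)) {n N : ℕ} (h : n ≤ N)
    {s : Set (VilenkinGroup m)} (hs : FirstCoords m n (· ∈ s)) :
    ∫ x in s, stopped m f l N x ∂(haar m) = ∫ x in s, stopped m f l n x ∂(haar m) := by
  induction N, h using Nat.le_induction with
  | base => rfl
  | succ N hN ih =>
    rw [← ih, ← sub_eq_zero,
      ← integral_sub (firstCoords_stopped hf (N + 1)).integrable.integrableOn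
        (firstCoords_stopped hf N).integrable.integrableOn]
    have hpt : ∀ x, stopped m f l (N + 1) x - stopped m f l N x =
        (exceed m f l (N + 1))ᶜ.indicator (fun x => f (N + 1) x - f N x) x := by
      intro x
      by_cases hx : x ∈ exceed m f l (N + 1)
      · rw [Set.indicator_of_notMem (by simpa using hx), stopped_succ, if_pos hx, sub_self]
      · rw [Set.indicator_of_mem (by simpa using hx), stopped_eq hx,
          stopped_eq fun h' => hx (exceed_mono N.le_succ h')]
    have hE : FirstCoords m N (· ∈ (exceed m f l (N + 1))ᶜ) :=
      (firstCoords_exceed (f := f) (l := l) le_rfl).comp Not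
    simp only [hpt]
    rw [setIntegral_indicator ((filtration m).le N _ hE.measurableSet)]
    exact setIntegral_martingale hf N.le_succ ((hs.mono hN).comp₂ hE And)

/-- The points at which the stopping time of level `l` equals `n`. -/
def stopSet (m : ℕ → ℕ) (f : ℕ → VilenkinGroup m → ℂ) (l : ℝ≥0∞) (n : ℕ) :
    Set (VilenkinGroup m) :=
  exceed m f l (n + 1) \ exceed m f l n

omit [∀ k, NeZero (m k)] in
theorem firstCoords_stopSet (n : ℕ) : FirstCoords m n (· ∈ stopSet m f l n) :=
  (firstCoords_exceed (f := f) (l := l) le_rfl).comp₂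
    (firstCoords_exceed (f := f) (l := l) n.le_succ) fun a b => a ∧ ¬ b

omit [∀ k, NeZero (m k)] in
theorem mem_stopSet_of_mem_interval {n : ℕ} {x y : VilenkinGroup m} (hy : y ∈ stopSet m f l n)
    (hx : x ∈ interval m n y) : x ∈ stopSet m f l n :=
  (iff_of_eq (firstCoords_stopSet n y x hx)).2 hy

omit [∀ k, NeZero (m k)] in
theorem stopSet_unique {n k : ℕ} {x : VilenkinGroup m} (hn : x ∈ stopSet m f l n)
    (hk : x ∈ stopSet m f l k) : n = k := by
  rcases lt_trichotomy n k with h | h | h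
  · exact absurd (exceed_mono h hn.1) hk.2
  · exact h
  · exact absurd (exceed_mono h hk.1) hn.2

omit [∀ k, NeZero (m k)] in
open Classical in
theorem sum_stopSet (N : ℕ) (x : VilenkinGroup m) (z : ℂ) (hz : x ∉ exceed m f l N → z = 0) :
    ∑ n ∈ Finset.range N, (if x ∈ stopSet m f l n then z else 0) = z := by
  have key : ∀ N, ∑ n ∈ Finset.range N, (if x ∈ stopSet m f l n then z else 0) =
      if x ∈ exceed m f l N then z else 0 := by
    intro N
    induction N with
    | zero => simp [exceed]
    | succ N ih =>
      rw [Finset.sum_range_succ, ih]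
      by_cases h1 : x ∈ exceed m f l N
      · have h2 : x ∈ exceed m f l (N + 1) := exceed_mono N.le_succ h1
        simp [stopSet, h1, h2]
      · simp [stopSet, h1]
  rw [key]
  split_ifs with h
  · rfl
  · exact (hz h).symm

open Classical in
/-- The part of the difference of two stopped martingales that lives on one interval. -/
noncomputable def atom (m : ℕ → ℕ) (f : ℕ → VilenkinGroup m → ℂ) (l l' : ℝ≥0∞) (N n : ℕ)
    (j : Label m n) (x : VilenkinGroup m) : ℂ :=
  if ext m n j ∈ stopSet m f l n then
    (interval m n (ext m n j)).indicator (fun x => stopped m f l' N x - stopped m f l N x) x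
  else 0

/-- The two stopped martingales differ only where the lower level has been exceeded, and that set is
partitioned by the stopping time and then into intervals. -/
theorem sum_atom {l' : ℝ≥0∞} (h : l ≤ l') (N : ℕ) (x : VilenkinGroup m) :
    ∑ n ∈ Finset.range N, ∑ j : Label m n, atom m f l l' N n j x =
      stopped m f l' N x - stopped m f l N x := by
  classical
  have hz : x ∉ exceed m f l N → stopped m f l' N x - stopped m f l N x = 0 := by
    intro hx
    rw [stopped_eq hx, stopped_eq fun h' => hx (exceed_anti h N h'), sub_self]
  rw [← sum_stopSet N x _ hz]
  refine Finset.sum_congr rfl fun n _ => ?_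
  rw [← sum_indicator_interval n (fun x => stopped m f l' N x - stopped m f l N x) x]
  have : ∀ j : Label m n, atom m f l l' N n j x = if x ∈ stopSet m f l n then
      (interval m n (ext m n j)).indicator
        (fun x => stopped m f l' N x - stopped m f l N x) x else 0 := by
    intro j
    by_cases hx : x ∈ interval m n (ext m n j)
    · have := firstCoords_stopSet (f := f) (l := l) n _ _ hx
      simp only [eq_iff_iff] at this
      simp only [atom, this]
    · simp [atom, hx]
  simp only [this]
  split_ifs <;> simp

omit [∀ k, NeZero (m k)] in
theorem firstCoords_atom (hf : Martingale f (filtration m) (haar m)) (l' : ℝ≥0∞) {N n : ℕ}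
    (h : n ≤ N) (j : Label m n) : FirstCoords m N (atom m f l l' N n j) := by
  classical
  have h1 : FirstCoords m N fun x => stopped m f l' N x - stopped m f l N x :=
    (firstCoords_stopped hf N).comp₂ (firstCoords_stopped hf N) _
  have h2 := firstCoords_mem_interval h (ext m n j)
  intro x y hy
  have h3 := h1 x y hy
  have h4 := h2 x y hy
  simp only [eq_iff_iff] at h4
  simp only [atom, Set.indicator_apply, h4, h3]

/-- On `stopSet m f l n` both stopped martingales still equal `f^{(n)}` at time `n`, and their
integrals over an interval of rank `n` do not change afterwards. -/
theorem integral_atom (hf : Martingale f (filtration m) (haar m)) {l' : ℝ≥0∞} (hl : l ≤ l')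
    {N n : ℕ} (h : n ≤ N) (j : Label m n) : ∫ x, atom m f l l' N n j x ∂(haar m) = 0 := by
  classical
  by_cases hj : ext m n j ∈ stopSet m f l n
  · simp only [atom, if_pos hj]
    rw [integral_indicator (measurableSet_interval _ _),
      integral_sub (firstCoords_stopped hf N).integrable.integrableOn
        (firstCoords_stopped hf N).integrable.integrableOn,
      setIntegral_stopped hf h (firstCoords_mem_interval le_rfl _),
      setIntegral_stopped hf h (firstCoords_mem_interval le_rfl _), sub_eq_zero]
    refine setIntegral_congr_fun (measurableSet_interval _ _) fun x hx => ?_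
    have hx' := (mem_stopSet_of_mem_interval hj hx).2
    rw [stopped_eq hx', stopped_eq fun h' => hx' (exceed_anti hl n h')]
  · simp [atom, hj]

omit [∀ k, NeZero (m k)] in
theorem enorm_atom_le {l' : ℝ≥0∞} (h0 : ∀ x, ‖f 0 x‖ₑ ≤ l) (hl : l ≤ l') (N n : ℕ)
    (j : Label m n) (x : VilenkinGroup m) : ‖atom m f l l' N n j x‖ₑ ≤ l' + l := by
  classical
  rw [atom]
  split_ifs
  · by_cases hx : x ∈ interval m n (ext m n j)
    · rw [Set.indicator_of_mem hx]
      exact (enorm_sub_le).trans (add_le_add (enorm_stopped_le (fun x => (h0 x).trans hl) N x)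
        (enorm_stopped_le h0 N x))
    · simp [hx]
  · simp

theorem exists_stopped_eq (hf : Martingale f (filtration m) (haar m)) {u : ℕ → ℝ≥0∞}
    (hu : Tendsto u atTop (𝓝 ∞)) (N : ℕ) : ∃ κ, ∀ x, stopped m f (u κ) N x = f N x := by
  choose C hC using fun n => (firstCoords_of_martingale hf n).exists_bound
  have : ∀ᶠ k in atTop, ∑ j ∈ Finset.range N, ENNReal.ofReal (C (j + 1)) < u k :=
    hu.eventually (lt_mem_nhds
      (ENNReal.sum_lt_top.2 fun _ _ => ENNReal.ofReal_lt_top))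
  obtain ⟨κ, hκ⟩ := this.exists
  refine ⟨κ, fun x => stopped_eq ?_⟩
  rintro ⟨j, hj, y, -, hy⟩
  refine absurd hy (not_lt.2 (le_trans ?_ hκ.le))
  calc ‖f (j + 1) y‖ₑ ≤ ENNReal.ofReal (C (j + 1)) := by
        rw [← ofReal_norm]
        exact ENNReal.ofReal_le_ofReal (hC _ y)
    _ ≤ _ := Finset.single_le_sum (f := fun j => ENNReal.ofReal (C (j + 1)))
        (fun _ _ => zero_le) (Finset.mem_range.2 hj)

/-- The levels of the stopping times. -/
noncomputable def level (l : ℝ≥0) (k : ℕ) : ℝ≥0 := 4 ^ k * l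

open Classical in
/-- The coefficient of `tail` in the estimate for the Fejér means. -/
noncomputable def coeff (m : ℕ → ℕ) (b : ℕ) (f : ℕ → VilenkinGroup m → ℂ) (l : ℝ≥0)
    (i : ℕ × (n : ℕ) × Label m n) : ℝ≥0 :=
  if ext m i.2.1 i.2.2 ∈ stopSet m f (level l i.1) i.2.1 then
    30 * b ^ 2 * level l i.1 * (bigM m i.2.1 : ℝ≥0)⁻¹ ^ 2
  else 0

theorem tendsto_level {l : ℝ≥0} (hl : 0 < l) :
    Tendsto (fun k => (level l k : ℝ≥0∞)) atTop (𝓝 ∞) := by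
  rw [ENNReal.tendsto_coe_nhds_top]
  exact (tendsto_pow_atTop_atTop_of_one_lt (by norm_num)).atTop_mul_const hl

/-- Telescoping over the levels writes `f^{(N)}` as its version stopped at `l` plus atoms. A point
outside every `exceed` set lies off the supports of all nonzero atoms, so the off-support estimate
applies to each of them. -/
theorem enorm_sum_partialSum_le (hm : ∀ k, 2 ≤ m k) {b : ℕ} (hb : ∀ k, m k ≤ b)
    (hf : Martingale f (filtration m) (haar m)) {l : ℝ≥0} (hl : 0 < l)
    (h0 : ∀ x, ‖f 0 x‖ₑ ≤ l) (n : ℕ) {x : VilenkinGroup m}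
    (hx : ∀ N, x ∉ exceed m f l N) :
    ‖∑ k ∈ Finset.range n, partialSum m f k x‖ₑ ≤
      n * (12 * b ^ 3 * l + ∑' i, coeff m b f l i * tail m i.2.1 (ext m i.2.1 i.2.2) x) := by
  classical
  -- The number of terms doubles as the rank at which `f` is sampled, because `n < M_n`.
  have hnN : n ≤ bigM m n := (lt_bigM m hm n).le
  set N := n
  clear_value N
  rw [sum_partialSum_eq_integral hm hf hnN]
  obtain ⟨κ, hκ⟩ := exists_stopped_eq hf (tendsto_level hl) N
  have hlev : ∀ k, l ≤ level l k := fun k => le_mul_of_one_le_left' (one_le_pow₀ (by norm_num))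
  have hlev0 : (level l 0 : ℝ≥0∞) = l := by simp [level]
  have hlevs : ∀ k, (level l (k + 1) : ℝ≥0∞) = 4 * level l k := by
    intro k
    simp only [level, pow_succ]
    push_cast
    ring
  have hlevm : ∀ k, (level l k : ℝ≥0∞) ≤ level l (k + 1) := by
    intro k
    rw [hlevs]
    exact le_mul_of_one_le_left' (by norm_num)
  have hdec : ∀ t, f N t = stopped m f l N t + ∑ k ∈ Finset.range κ, ∑ n ∈ Finset.range N,
      ∑ j : Label m n, atom m f (level l k) (level l (k + 1)) N n j t := by
    intro t
    simp only [sum_atom (hlevm _)]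
    rw [Finset.sum_range_sub fun k => stopped m f (level l k) N t, hκ, hlev0]
    ring
  have hfej : FirstCoords m N (fejer m N x) := firstCoords_fejer hm hnN x
  have hatom : ∀ k, ∀ n ∈ Finset.range N, ∀ j : Label m n, Integrable
      (fun t => atom m f (level l k) (level l (k + 1)) N n j t * fejer m N x t) (haar m) :=
    fun k n hn j => ((firstCoords_atom hf _ (Finset.mem_range.1 hn).le j).comp₂ hfej
      (· * ·)).integrable
  have hatom' : ∀ k, ∀ n ∈ Finset.range N, Integrable
      (fun t => ∑ j : Label m n,
        atom m f (level l k) (level l (k + 1)) N n j t * fejer m N x t) (haar m) :=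
    fun k n hn => integrable_finsetSum _ fun j _ => hatom k n hn j
  have hatom'' : ∀ k, Integrable
      (fun t => ∑ n ∈ Finset.range N, ∑ j : Label m n,
        atom m f (level l k) (level l (k + 1)) N n j t * fejer m N x t) (haar m) :=
    fun k => integrable_finsetSum _ fun n hn => hatom' k n hn
  simp only [hdec, add_mul, Finset.sum_mul]
  rw [integral_add ((firstCoords_stopped hf N).comp₂ hfej (· * ·)).integrable
    (integrable_finsetSum _ fun k _ => hatom'' k),
    integral_finsetSum _ fun k _ => hatom'' k, mul_add]
  refine (enorm_add_le _ _).trans (add_le_add ?_ ?_)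
  · exact enorm_integral_mul_fejer_le hm hb (enorm_stopped_le h0 N) N x
  rw [← ENNReal.tsum_mul_left, ENNReal.tsum_prod']
  refine (enorm_sum_le _ _).trans (le_trans ?_ (ENNReal.sum_le_tsum (Finset.range κ)))
  refine Finset.sum_le_sum fun k _ => ?_
  rw [integral_finsetSum _ fun n hn => hatom' k n hn, ENNReal.tsum_sigma']
  refine (enorm_sum_le _ _).trans (le_trans ?_ (ENNReal.sum_le_tsum (Finset.range N)))
  refine Finset.sum_le_sum fun n hn => ?_
  rw [integral_finsetSum _ fun j _ => hatom k n hn j, tsum_fintype]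
  refine (enorm_sum_le _ _).trans (Finset.sum_le_sum fun j _ => ?_)
  by_cases hj : ext m n j ∈ stopSet m f (level l k) n
  · have hxj : x ∉ interval m n (ext m n j) := by
      intro h
      exact hx (n + 1) (exceed_anti (by exact_mod_cast hlev k) _
        (mem_stopSet_of_mem_interval hj h).1)
    refine (enorm_integral_atom_mul_fejer_le hm hb
      (enorm_atom_le (fun x => (h0 x).trans (by exact_mod_cast hlev k)) (hlevm k) N n j)
      (fun t ht => by simp [atom, ht]) (integral_atom hf (hlevm k) (Finset.mem_range.1 hn).le j)
      N hxj).trans (le_of_eq ?_)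
    simp only [coeff, if_pos hj]
    have : (bigM m n : ℝ≥0) ≠ 0 := by exact_mod_cast (bigM_pos n).ne'
    -- The atom is bounded by `4 · level + level`, whence `30 = 6 · 5`.
    rw [hlevs]
    push_cast [ENNReal.coe_inv this]
    ring
  · simp [atom, hj]

end Vilenkin

/-! ### Proof of a): the distributional estimate for the maximal operator. -/

namespace Vilenkin

variable {m : ℕ → ℕ} [∀ k, NeZero (m k)] {f : ℕ → VilenkinGroup m → ℂ}

/-! ### The stopping intervals -/

theorem measurable_maximalFunction (hf : Martingale f (filtration m) (haar m)) :
    Measurable (maximalFunction m f) :=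
  .iSup fun n => (firstCoords_of_martingale hf n).measurable.enorm

omit [∀ k, NeZero (m k)] in
theorem exists_lt_of_mem_stopSet {l : ℝ≥0∞} {n : ℕ} {x : VilenkinGroup m}
    (hx : x ∈ stopSet m f l n) : ∃ y ∈ interval m n x, l < ‖f (n + 1) y‖ₑ := by
  obtain ⟨⟨j, hj, y, hy, hl⟩, h2⟩ := hx
  rcases Nat.lt_succ_iff_lt_or_eq.1 hj with h | rfl
  · exact absurd ⟨j, h, y, hy, hl⟩ h2
  · exact ⟨y, hy, hl⟩

/-- A stopping interval of rank `n` contains an interval of rank `n + 1` on which `|f^{(n+1)}| > l`,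
that is, a proportion `1 / m_n ≥ 1 / b` of it. -/
theorem inv_bigM_le_measure (hf : Martingale f (filtration m) (haar m)) {b : ℕ}
    (hb : ∀ k, m k ≤ b) {l : ℝ≥0∞} {n : ℕ} {x : VilenkinGroup m} (hx : x ∈ stopSet m f l n) :
    (bigM m n : ℝ≥0∞)⁻¹ ≤ b * haar m (interval m n x ∩ {z | l < maximalFunction m f z}) := by
  obtain ⟨y, hy, hl⟩ := exists_lt_of_mem_stopSet hx
  have hsub : interval m (n + 1) y ⊆ interval m n x ∩ {z | l < maximalFunction m f z} := by
    intro z hz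
    refine ⟨mem_interval_trans hy (interval_anti n.le_succ y hz), ?_⟩
    rw [← firstCoords_of_martingale hf (n + 1) y z hz] at hl
    exact hl.trans_le (le_iSup (fun k => ‖f k z‖ₑ) (n + 1))
  refine le_trans ?_ (mul_le_mul_right (measure_mono hsub) _)
  have h0 : (m n : ℝ≥0∞) ≠ 0 := by exact_mod_cast NeZero.ne (m n)
  rw [haar_interval, bigM, Nat.cast_mul, ENNReal.mul_inv (Or.inl h0) (Or.inl (by simp)),
    ← mul_assoc]
  refine le_mul_of_one_le_left' ?_
  rw [← ENNReal.mul_inv_cancel h0 (by simp)]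
  gcongr
  exact_mod_cast hb n

omit [∀ k, NeZero (m k)] in
theorem eq_of_mem_stopSet {l : ℝ≥0∞} {p q : (n : ℕ) × Label m n} {x : VilenkinGroup m}
    (hp : ext m p.1 p.2 ∈ stopSet m f l p.1) (hq : ext m q.1 q.2 ∈ stopSet m f l q.1)
    (hxp : x ∈ interval m p.1 (ext m p.1 p.2)) (hxq : x ∈ interval m q.1 (ext m q.1 q.2)) :
    p = q := by
  obtain ⟨n, j⟩ := p
  obtain ⟨k, i⟩ := q
  obtain rfl : n = k := stopSet_unique (mem_stopSet_of_mem_interval hp hxp)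
    (mem_stopSet_of_mem_interval hq hxq)
  have h1 : j = res m n x := mem_interval_ext_iff.1 hxp
  have h2 : i = res m n x := mem_interval_ext_iff.1 hxq
  rw [h1, h2]

open Classical in
-- The stopping intervals of one level are disjoint, and each is filled to a proportion at least `1
-- / b` by the set where `f^* > l`.
theorem tsum_stopSet_le (hf : Martingale f (filtration m) (haar m)) {b : ℕ}
    (hb : ∀ k, m k ≤ b) (l : ℝ≥0∞) :
    ∑' p : (n : ℕ) × Label m n,
      (if ext m p.1 p.2 ∈ stopSet m f l p.1 then (bigM m p.1 : ℝ≥0∞)⁻¹ else 0) ≤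
      b * haar m {z | l < maximalFunction m f z} := by
  set S : Set (VilenkinGroup m) := {z | l < maximalFunction m f z} with hS
  have hSm : MeasurableSet S := measurableSet_lt measurable_const (measurable_maximalFunction hf)
  set As : (n : ℕ) × Label m n → Set (VilenkinGroup m) := fun p =>
    if ext m p.1 p.2 ∈ stopSet m f l p.1 then interval m p.1 (ext m p.1 p.2) ∩ S else ∅ with hAs
  have hmem : ∀ {p x}, x ∈ As p →
      ext m p.1 p.2 ∈ stopSet m f l p.1 ∧ x ∈ interval m p.1 (ext m p.1 p.2) ∩ S := by
    intro p x hx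
    simp only [hAs] at hx
    split_ifs at hx with h
    · exact ⟨h, hx⟩
    · exact absurd hx (Set.notMem_empty x)
  calc _ ≤ ∑' p, b * haar m (As p) := by
        refine ENNReal.tsum_le_tsum fun p => ?_
        simp only [hAs]
        split_ifs with h
        · exact inv_bigM_le_measure hf hb h
        · exact zero_le
    _ = b * ∑' p, haar m (As p) := ENNReal.tsum_mul_left
    _ ≤ b * haar m (⋃ p, As p) := by
        gcongr
        refine tsum_meas_le_meas_iUnion_of_disjoint _ (fun p => ?_) fun p q hpq => ?_
        · simp only [hAs]
          split_ifs
          · exact (measurableSet_interval _ _).inter hSm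
          · exact MeasurableSet.empty
        · refine Set.disjoint_left.2 fun x hp hq => hpq ?_
          exact eq_of_mem_stopSet (hmem hp).1 (hmem hq).1 (hmem hp).2.1 (hmem hq).2.1
    _ ≤ _ := by
        gcongr
        exact Set.iUnion_subset fun p x hx => (hmem hx).2.2

theorem measure_exceed_le (hf : Martingale f (filtration m) (haar m)) {b : ℕ}
    (hb : ∀ k, m k ≤ b) (l : ℝ≥0∞) :
    haar m (⋃ N, exceed m f l N) ≤ b * haar m {z | l < maximalFunction m f z} := by
  classical
  have hsub : (⋃ N, exceed m f l N) ⊆ ⋃ p : (n : ℕ) × Label m n,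
      if ext m p.1 p.2 ∈ stopSet m f l p.1 then interval m p.1 (ext m p.1 p.2) else ∅ := by
    intro x hx
    have hex : ∃ n, x ∈ exceed m f l n := Set.mem_iUnion.1 hx
    obtain ⟨n, hn⟩ : ∃ n, Nat.find hex = n + 1 := by
      refine Nat.exists_eq_succ_of_ne_zero fun h0 => ?_
      have := Nat.find_spec hex
      rw [h0] at this
      obtain ⟨j, hj, -⟩ := this
      exact absurd hj (Nat.not_lt_zero j)
    have hxs : x ∈ stopSet m f l n :=
      ⟨hn ▸ Nat.find_spec hex, Nat.find_min hex (hn ▸ n.lt_succ_self)⟩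
    refine Set.mem_iUnion.2 ⟨⟨n, res m n x⟩, ?_⟩
    have := mem_interval_ext_res n x
    simp only
    rw [if_pos (mem_stopSet_of_mem_interval hxs (mem_interval_comm.1 this))]
    exact this
  refine (measure_mono hsub).trans ((measure_iUnion_le _).trans (le_trans ?_
    (tsum_stopSet_le hf hb l)))
  refine ENNReal.tsum_le_tsum fun p => ?_
  split_ifs
  · exact (haar_interval _ _).le
  · simp

theorem level_rpow (l : ℝ≥0) (k : ℕ) :
    (level l k) ^ (1 / 2 : ℝ) = 2 ^ k * l ^ (1 / 2 : ℝ) := by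
  rw [level, NNReal.mul_rpow, ← NNReal.rpow_natCast, ← NNReal.rpow_mul, mul_comm (k : ℝ),
    NNReal.rpow_mul, NNReal.rpow_natCast, show (4 : ℝ≥0) = 2 ^ (2 : ℝ) by norm_num,
    ← NNReal.rpow_mul]
  norm_num

open Classical in
-- Levels grow by the factor `4`, so their square roots double and the sum is at most twice its last
-- nonzero term.
theorem tsum_level_le (l : ℝ≥0) (v : ℝ≥0∞) :
    ∑' k, (if (level l k : ℝ≥0∞) < v then ((level l k ^ (1 / 2 : ℝ) : ℝ≥0) : ℝ≥0∞) else 0) ≤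
      2 * v ^ (1 / 2 : ℝ) := by
  rw [ENNReal.tsum_eq_iSup_nat]
  refine iSup_le fun K => ?_
  have hgeom : ∀ K, ∑ k ∈ Finset.range (K + 1), level l k ^ (1 / 2 : ℝ) ≤
      2 * level l K ^ (1 / 2 : ℝ) := by
    intro K
    simp only [level_rpow]
    rw [← Finset.sum_mul, ← mul_assoc]
    gcongr
    induction K with
    | zero => simp
    | succ K ih =>
      rw [Finset.sum_range_succ]
      calc _ ≤ (2 : ℝ≥0) * 2 ^ K + 2 ^ (K + 1) := by gcongr
        _ = _ := by ring
  induction K with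
  | zero => simp
  | succ K ih =>
    by_cases h : (level l K : ℝ≥0∞) < v
    · calc _ ≤ ∑ k ∈ Finset.range (K + 1), ((level l k ^ (1 / 2 : ℝ) : ℝ≥0) : ℝ≥0∞) := by
            refine Finset.sum_le_sum fun k _ => ?_
            split_ifs
            · exact le_rfl
            · exact zero_le
        _ ≤ ((2 * level l K ^ (1 / 2 : ℝ) : ℝ≥0) : ℝ≥0∞) := by exact_mod_cast hgeom K
        _ = 2 * (level l K : ℝ≥0∞) ^ (1 / 2 : ℝ) := by
            rw [ENNReal.coe_mul, ENNReal.coe_rpow_of_nonneg _ (by norm_num)]; rfl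
        _ ≤ _ := by gcongr
    · rw [Finset.sum_range_succ, if_neg h, add_zero]
      exact ih

theorem tsum_level_measure_le (hf : Martingale f (filtration m) (haar m)) (l : ℝ≥0) :
    ∑' k, ((level l k ^ (1 / 2 : ℝ) : ℝ≥0) : ℝ≥0∞) *
      haar m {z | (level l k : ℝ≥0∞) < maximalFunction m f z} ≤
      2 * ∫⁻ x, maximalFunction m f x ^ (1 / 2 : ℝ) ∂(haar m) := by
  classical
  have hM := measurable_maximalFunction hf
  have hS : ∀ k, MeasurableSet {z | (level l k : ℝ≥0∞) < maximalFunction m f z} :=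
    fun k => measurableSet_lt measurable_const hM
  calc _ = ∑' k, ∫⁻ x, {z | (level l k : ℝ≥0∞) < maximalFunction m f z}.indicator
          (fun _ => ((level l k ^ (1 / 2 : ℝ) : ℝ≥0) : ℝ≥0∞)) x ∂(haar m) := by
        simp only [lintegral_indicator_const (hS _)]
    _ = ∫⁻ x, ∑' k, {z | (level l k : ℝ≥0∞) < maximalFunction m f z}.indicator
          (fun _ => ((level l k ^ (1 / 2 : ℝ) : ℝ≥0) : ℝ≥0∞)) x ∂(haar m) :=
        (lintegral_tsum fun k => (measurable_const.indicator (hS k)).aemeasurable).symm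
    _ ≤ ∫⁻ x, 2 * maximalFunction m f x ^ (1 / 2 : ℝ) ∂(haar m) := by
        refine lintegral_mono fun x => ?_
        simp only [Set.indicator_apply, Set.mem_ofPred_eq]
        exact tsum_level_le l _
    _ = _ := lintegral_const_mul _ (hM.pow_const _)

/-- The exponent `1/2` matters here: the square root turns `M_n⁻²` into the measure `M_n⁻¹` of the
stopping interval. Summing over the intervals gives the measure of `{f^* > 4^k l}`, and summing over
`k` gives a layer-cake bound by `∫ (f^*)^{1/2}`. -/
theorem tsum_coeff_rpow_le (hf : Martingale f (filtration m) (haar m)) {b : ℕ}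
    (hb : ∀ k, m k ≤ b) (l : ℝ≥0) :
    ∑' i, ((coeff m b f l i ^ (1 / 2 : ℝ) : ℝ≥0) : ℝ≥0∞) ≤
      ((30 * b ^ 2 : ℝ≥0) ^ (1 / 2 : ℝ) : ℝ≥0) * b *
        (2 * ∫⁻ x, maximalFunction m f x ^ (1 / 2 : ℝ) ∂(haar m)) := by
  classical
  set D : ℝ≥0 := (30 * b ^ 2 : ℝ≥0) ^ (1 / 2 : ℝ) with hD
  have hco : ∀ k (p : (n : ℕ) × Label m n),
      ((coeff m b f l (k, p) ^ (1 / 2 : ℝ) : ℝ≥0) : ℝ≥0∞) =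
      (D * level l k ^ (1 / 2 : ℝ) : ℝ≥0) *
      (if ext m p.1 p.2 ∈ stopSet m f (level l k) p.1 then (bigM m p.1 : ℝ≥0∞)⁻¹ else 0) := by
    intro k p
    simp only [coeff]
    split_ifs
    · have : (bigM m p.1 : ℝ≥0) ≠ 0 := by exact_mod_cast (bigM_pos p.1).ne'
      have hsq : ∀ x : ℝ≥0, (x ^ 2) ^ (1 / 2 : ℝ) = x := by
        intro x
        rw [← NNReal.rpow_natCast, ← NNReal.rpow_mul]
        norm_num
      rw [NNReal.mul_rpow, NNReal.mul_rpow, hsq, ← hD, ENNReal.coe_mul, ENNReal.coe_inv this]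
      rfl
    · simp
  rw [ENNReal.tsum_prod']
  calc _ ≤ ∑' k, (D * b : ℝ≥0∞) * (((level l k ^ (1 / 2 : ℝ) : ℝ≥0) : ℝ≥0∞) *
        haar m {z | (level l k : ℝ≥0∞) < maximalFunction m f z}) := by
        refine ENNReal.tsum_le_tsum fun k => ?_
        simp only [hco, ENNReal.tsum_mul_left]
        refine (mul_le_mul_right (tsum_stopSet_le hf hb (level l k)) _).trans (le_of_eq ?_)
        rw [ENNReal.coe_mul]
        ring
    _ = (D * b : ℝ≥0∞) * ∑' k, (((level l k ^ (1 / 2 : ℝ) : ℝ≥0) : ℝ≥0∞) *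
        haar m {z | (level l k : ℝ≥0∞) < maximalFunction m f z}) := ENNReal.tsum_mul_left
    _ ≤ _ := by
        gcongr
        exact tsum_level_measure_le hf l

/-- Markov's inequality for the maximal function. -/
theorem measure_lt_maximalFunction_le (hf : Martingale f (filtration m) (haar m)) {l : ℝ≥0}
    (hl : 0 < l) :
    haar m {z | (l : ℝ≥0∞) < maximalFunction m f z} ≤
      (∫⁻ x, maximalFunction m f x ^ (1 / 2 : ℝ) ∂(haar m)) * ((l⁻¹) ^ (1 / 2 : ℝ) : ℝ≥0) := by
  have h0 : l ^ (1 / 2 : ℝ) ≠ 0 := by positivity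
  have hsub : {z | (l : ℝ≥0∞) < maximalFunction m f z} ⊆
      {z | ((l ^ (1 / 2 : ℝ) : ℝ≥0) : ℝ≥0∞) ≤ maximalFunction m f z ^ (1 / 2 : ℝ)} := by
    intro z hz
    simp only [Set.mem_ofPred_eq]
    rw [ENNReal.coe_rpow_of_nonneg _ (by norm_num)]
    exact ENNReal.rpow_le_rpow (le_of_lt hz) (by norm_num)
  refine (measure_mono hsub).trans ((meas_ge_le_lintegral_div
    ((measurable_maximalFunction hf).pow_const _).aemeasurable (by exact_mod_cast h0)
    ENNReal.coe_ne_top).trans (le_of_eq ?_))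
  rw [NNReal.inv_rpow, ENNReal.coe_inv h0, div_eq_mul_inv]

/-! ### Means with respect to non-increasing weights -/

omit [∀ k, NeZero (m k)] in
theorem norm_sum_mul_le {q : ℕ → ℝ} (hq_nonneg : ∀ k, 0 ≤ q k) (hq_anti : Antitone q)
    {s : ℕ → ℂ} {Z : ℝ} (n : ℕ)
    (h : ∀ j ≤ n, ‖∑ k ∈ Finset.range j, s k‖ ≤ j * Z) :
    ‖∑ k ∈ Finset.range n, (q k : ℂ) * s k‖ ≤ bigQ q n * Z := by
  -- Abel summation: the difference combines the partial sums of `s` with weights `q k - q (k + 1) ≥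
  -- 0`, and `∑_{k<n} (k + 1) (q k - q (k + 1)) = Q_n - n q_n`.
  have key : ‖∑ k ∈ Finset.range n, (q k : ℂ) * s k - q n * ∑ k ∈ Finset.range n, s k‖ ≤
      (bigQ q n - n * q n) * Z := by
    induction n with
    | zero => simp [bigQ]
    | succ n ih =>
      have e : ∑ k ∈ Finset.range (n + 1), (q k : ℂ) * s k -
          q (n + 1) * ∑ k ∈ Finset.range (n + 1), s k =
          (∑ k ∈ Finset.range n, (q k : ℂ) * s k - q n * ∑ k ∈ Finset.range n, s k) +
          ((q n - q (n + 1) : ℝ) : ℂ) * ∑ k ∈ Finset.range (n + 1), s k := by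
        rw [Finset.sum_range_succ, Finset.sum_range_succ]
        push_cast
        ring
      have hd : 0 ≤ q n - q (n + 1) := sub_nonneg.2 (hq_anti n.le_succ)
      rw [e]
      refine (norm_add_le _ _).trans ((add_le_add (ih fun j hj => h j (hj.trans n.le_succ))
        (le_of_eq (norm_mul _ _))).trans ?_)
      rw [Complex.norm_real, Real.norm_of_nonneg hd]
      have h2 := mul_le_mul_of_nonneg_left (h (n + 1) le_rfl) hd
      have h3 : bigQ q (n + 1) = bigQ q n + q n := Finset.sum_range_succ _ _
      rw [h3]
      push_cast at h2 ⊢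
      linarith
  have h1 : ‖(q n : ℂ) * ∑ k ∈ Finset.range n, s k‖ ≤ q n * (n * Z) := by
    rw [norm_mul, Complex.norm_real, Real.norm_of_nonneg (hq_nonneg n)]
    exact mul_le_mul_of_nonneg_left (h n le_rfl) (hq_nonneg n)
  calc _ = ‖(∑ k ∈ Finset.range n, (q k : ℂ) * s k - q n * ∑ k ∈ Finset.range n, s k) +
        q n * ∑ k ∈ Finset.range n, s k‖ := by rw [sub_add_cancel]
    _ ≤ _ := (norm_add_le _ _).trans (by linarith)

theorem bigQ_pos {q : ℕ → ℝ} (hq_nonneg : ∀ k, 0 ≤ q k) (hq_zero : 0 < q 0) {n : ℕ}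
    (hn : 0 < n) : 0 < bigQ q n :=
  Finset.sum_pos' (fun k _ => hq_nonneg k) ⟨0, Finset.mem_range.2 hn, hq_zero⟩

theorem enorm_mean_le {q : ℕ → ℝ} (hq_nonneg : ∀ k, 0 ≤ q k) (hq_zero : 0 < q 0)
    (hq_anti : Antitone q) {s : ℕ → ℂ} {Z : ℝ≥0∞} (n : ℕ)
    (h : ∀ j, ‖∑ k ∈ Finset.range j, s k‖ₑ ≤ j * Z) :
    ‖((bigQ q n : ℝ) : ℂ)⁻¹ * ∑ k ∈ Finset.range n, (q k : ℂ) * s k‖ₑ ≤ Z := by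
  rcases Nat.eq_zero_or_pos n with rfl | hn
  · simp
  rcases eq_or_ne Z ∞ with rfl | hZ
  · exact le_top
  lift Z to ℝ≥0 using hZ
  have hQ := bigQ_pos hq_nonneg hq_zero hn
  have h1 := norm_sum_mul_le hq_nonneg hq_anti (s := s) (Z := Z) n fun j _ => by
    have := h j
    rw [← ENNReal.coe_natCast, ← ENNReal.coe_mul, enorm_le_coe] at this
    exact_mod_cast this
  rw [enorm_le_coe, ← NNReal.coe_le_coe, coe_nnnorm, norm_mul, norm_inv, Complex.norm_real,
    Real.norm_of_nonneg hQ.le, inv_mul_le_iff₀ hQ]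
  exact h1

theorem measurable_psi (n : ℕ) : Measurable (psi m n) :=
  Finset.measurable_prod _ fun k _ => ((firstCoords_rademacher k).measurable).pow_const _

theorem measurable_tMaximal (q : ℕ → ℝ) (f : ℕ → VilenkinGroup m → ℂ) :
    Measurable (tMaximal m q f) := by
  refine .iSup fun n => Measurable.enorm ?_
  refine measurable_const.mul (Finset.measurable_sum _ fun k _ => measurable_const.mul ?_)
  exact Finset.measurable_sum _ fun i _ => measurable_const.mul (measurable_psi i)

/-- The constant in the distributional estimate for `T^*`. -/
noncomputable def weakConst (b : ℕ) : ℝ≥0∞ :=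
  (b + 4 * tailConst b * (((30 * b ^ 2 : ℝ≥0) ^ (1 / 2 : ℝ) : ℝ≥0) * b) + 1) *
    ((24 * b ^ 3 : ℝ≥0) ^ (1 / 2 : ℝ) : ℝ≥0)

theorem weakConst_ne_top (b : ℕ) : weakConst b ≠ ∞ := by
  have := tailConst_ne_top b
  unfold weakConst
  finiteness

theorem measure_lt_tMaximal_le (hm : ∀ k, 2 ≤ m k) {b : ℕ} (hb : ∀ k, m k ≤ b)
    {q : ℕ → ℝ} (hq_nonneg : ∀ k, 0 ≤ q k) (hq_zero : 0 < q 0) (hq_anti : Antitone q)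
    (hf : Martingale f (filtration m) (haar m)) {t : ℝ≥0} (ht : 0 < t) :
    haar m {x | (t : ℝ≥0∞) < tMaximal m q f x} ≤
      weakConst b * (∫⁻ x, maximalFunction m f x ^ (1 / 2 : ℝ) ∂(haar m)) *
        ((t⁻¹) ^ (1 / 2 : ℝ) : ℝ≥0) := by
  set H := ∫⁻ x, maximalFunction m f x ^ (1 / 2 : ℝ) ∂(haar m) with hH
  have hb0 : (0 : ℝ≥0) < b := by exact_mod_cast (NeZero.pos (m 0)).trans_le (hb 0)
  -- Then `12 b³ l = t / 2`: the bounded part uses half of `t`, and the atoms must supply the rest,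
  -- which is at least `l`.
  set l : ℝ≥0 := t / (24 * b ^ 3) with hl_def
  have hl : 0 < l := by positivity
  have htl : t = 24 * b ^ 3 * l := by rw [hl_def]; field_simp
  have hconv : (((l⁻¹) ^ (1 / 2 : ℝ) : ℝ≥0) : ℝ≥0∞) =
      ((24 * b ^ 3 : ℝ≥0) ^ (1 / 2 : ℝ) : ℝ≥0) * ((t⁻¹) ^ (1 / 2 : ℝ) : ℝ≥0) := by
    rw [← ENNReal.coe_mul, ← NNReal.mul_rpow, hl_def, inv_div, div_eq_mul_inv]
  have hmarkov := measure_lt_maximalFunction_le hf hl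
  suffices h : haar m {x | (t : ℝ≥0∞) < tMaximal m q f x} ≤
      (b + 4 * tailConst b * (((30 * b ^ 2 : ℝ≥0) ^ (1 / 2 : ℝ) : ℝ≥0) * b) + 1) * H *
        ((l⁻¹) ^ (1 / 2 : ℝ) : ℝ≥0) by
    refine h.trans (le_of_eq ?_)
    rw [hconv, weakConst]
    ring
  by_cases h0 : ∀ x, ‖f 0 x‖ₑ ≤ l
  · set W : VilenkinGroup m → ℝ≥0∞ := fun x =>
      ∑' i, coeff m b f l i * tail m i.2.1 (ext m i.2.1 i.2.2) x with hW
    have hsub : {x | (t : ℝ≥0∞) < tMaximal m q f x} ⊆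
        (⋃ N, exceed m f l N) ∪ {x | (l : ℝ≥0∞) ≤ W x} := by
      intro x hx
      by_contra hcon
      simp only [Set.mem_union, Set.mem_iUnion, Set.mem_ofPred_eq, not_or, not_exists,
        not_le] at hcon
      have hle : tMaximal m q f x ≤ 12 * b ^ 3 * l + W x :=
        iSup_le fun n => enorm_mean_le hq_nonneg hq_zero hq_anti n fun j =>
          enorm_sum_partialSum_le hm hb hf hl h0 j hcon.1
      refine absurd (lt_of_lt_of_le hx hle) (not_lt.2 ?_)
      have hb1 : (1 : ℝ≥0∞) ≤ b := by exact_mod_cast (NeZero.pos (m 0)).trans_le (hb 0)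
      calc 12 * (b : ℝ≥0∞) ^ 3 * l + W x ≤ 12 * b ^ 3 * l + 12 * b ^ 3 * l := by
            gcongr
            exact hcon.2.le.trans (le_mul_of_one_le_left'
              (one_le_mul (by norm_num) (one_le_pow₀ hb1)))
        _ = (t : ℝ≥0∞) := by rw [htl]; push_cast; ring
    have h1 : haar m (⋃ N, exceed m f l N) ≤ b * (H * ((l⁻¹) ^ (1 / 2 : ℝ) : ℝ≥0)) :=
      (measure_exceed_le hf hb l).trans (by gcongr)
    have h2 : haar m {x | (l : ℝ≥0∞) ≤ W x} ≤
        2 * tailConst b * (((30 * b ^ 2 : ℝ≥0) ^ (1 / 2 : ℝ) : ℝ≥0) * b * (2 * H)) *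
          ((l⁻¹) ^ (1 / 2 : ℝ) : ℝ≥0) :=
      (measure_le_tsum_le (C := tailConst b)
        (g := fun i : ℕ × (n : ℕ) × Label m n => tail m i.2.1 (ext m i.2.1 i.2.2))
        (fun i => measurable_tail _ _)
        (fun i r hr => exists_tail_exceptional hm hb i.2.1 (ext m i.2.1 i.2.2) r hr)
        (coeff m b f l) hl).trans
        (mul_le_mul_left (mul_le_mul_right (tsum_coeff_rpow_le hf hb l) _) _)
    refine (measure_mono hsub).trans ((measure_union_le _ _).trans
      ((add_le_add h1 h2).trans ?_))
    calc _ = (b + 4 * tailConst b * (((30 * b ^ 2 : ℝ≥0) ^ (1 / 2 : ℝ) : ℝ≥0) * b) + 0) * H *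
        ((l⁻¹) ^ (1 / 2 : ℝ) : ℝ≥0) := by ring
      _ ≤ _ := by gcongr; exact zero_le
  -- Since `f 0` is constant, `f^* > l` now holds everywhere and Markov's inequality bounds the
  -- total mass `1`; this case accounts for the `1` in `weakConst`.
  · push Not at h0
    obtain ⟨x₀, hx₀⟩ := h0
    have huniv : {z | (l : ℝ≥0∞) < maximalFunction m f z} = Set.univ := by
      refine Set.eq_univ_of_forall fun z => ?_
      rw [← firstCoords_of_martingale hf 0 x₀ z fun i hi => absurd hi (Nat.not_lt_zero i)] at hx₀
      exact hx₀.trans_le (le_iSup (fun k => ‖f k z‖ₑ) 0)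
    rw [huniv] at hmarkov
    refine (measure_mono (Set.subset_univ _)).trans (hmarkov.trans ?_)
    gcongr
    exact le_mul_of_one_le_left' le_add_self

theorem weakNorm_tMaximal_le (hm : ∀ k, 2 ≤ m k) {b : ℕ} (hb : ∀ k, m k ≤ b)
    {q : ℕ → ℝ} (hq_nonneg : ∀ k, 0 ≤ q k) (hq_zero : 0 < q 0) (hq_anti : Antitone q)
    (hf : Martingale f (filtration m) (haar m)) :
    weakNorm (haar m) (1 / 2) (tMaximal m q f) ≤
      weakConst b ^ 2 * hardyNorm m (1 / 2) f := by
  refine iSup₂_le fun t ht => ?_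
  simp only [enorm_eq_self]
  have h2 : (1 / (1 / 2) : ℝ) = 2 := by norm_num
  have hH : hardyNorm m (1 / 2) f =
      (∫⁻ x, maximalFunction m f x ^ (1 / 2 : ℝ) ∂(haar m)) ^ 2 := by
    rw [hardyNorm, eLpNorm_eq_lintegral_rpow_enorm_toReal (by simp) (by simp),
      ENNReal.toReal_ofReal (by norm_num), h2]
    simp
  rw [h2, hH, ENNReal.rpow_two]
  calc _ ≤ (t : ℝ≥0∞) * (weakConst b * (∫⁻ x, maximalFunction m f x ^ (1 / 2 : ℝ) ∂(haar m)) *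
        ((t⁻¹) ^ (1 / 2 : ℝ) : ℝ≥0)) ^ 2 := by
        gcongr
        exact measure_lt_tMaximal_le hm hb hq_nonneg hq_zero hq_anti hf ht
    _ = (t * ((((t⁻¹) ^ (1 / 2 : ℝ)) ^ 2 : ℝ≥0) : ℝ≥0∞)) * (weakConst b ^ 2 *
        (∫⁻ x, maximalFunction m f x ^ (1 / 2 : ℝ) ∂(haar m)) ^ 2) := by
        push_cast; ring
    _ = _ := by
        rw [← NNReal.rpow_natCast, ← NNReal.rpow_mul, ← ENNReal.coe_mul]
        norm_num [mul_inv_cancel₀ ht.ne']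

end Vilenkin

/-! ### Proof of b): a lacunary martingale with unbounded means. -/

namespace Vilenkin

variable {m : ℕ → ℕ} [∀ k, NeZero (m k)]

/-! ### Translation invariance -/

theorem map_add_right_haar (c : VilenkinGroup m) :
    Measure.map (fun x => x + c) (haar m) = haar m := by
  have h := Measure.infinitePi_map_pi (factorMeasure m) (f := fun i (z : ZMod (m i)) => z + c i)
    fun i => measurable_of_countable _
  have h' : ∀ i, Measure.map (fun z : ZMod (m i) => z + c i) (factorMeasure m i) =
      factorMeasure m i := by
    intro i
    rw [factorMeasure, Measure.map_smul, map_add_right_eq_self]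
  simp only [h'] at h
  exact h

theorem integral_add_right_haar {g : VilenkinGroup m → ℂ} (hg : Measurable g)
    (c : VilenkinGroup m) : ∫ x, g (x + c) ∂(haar m) = ∫ x, g x ∂(haar m) := by
  have hc : Measurable fun x : VilenkinGroup m => x + c :=
    measurable_pi_lambda _ fun i =>
      (measurable_of_countable fun z : ZMod (m i) => z + c i).comp (measurable_pi_apply i)
  conv_rhs => rw [← map_add_right_haar c]
  rw [integral_map hc.aemeasurable hg.aestronglyMeasurable]

theorem rademacher_eq_stdAddChar (k : ℕ) (x : VilenkinGroup m) :
    rademacher m k x = ZMod.stdAddChar (x k) := by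
  have := ZMod.stdAddChar_coe (N := m k) ((x k).val : ℤ)
  rw [Int.cast_natCast, ZMod.natCast_zmod_val, Int.cast_natCast] at this
  rw [this, rademacher]

/-! ### Blocks -/

/-- A multiple of a Rademacher function restricted to the interval of the same rank at `0`. -/
noncomputable def block (m : ℕ → ℕ) (w : ℝ) (a : ℕ) (x : VilenkinGroup m) : ℂ :=
  (interval m a 0).indicator (fun x => (w : ℂ) * rademacher m a x) x

omit [∀ k, NeZero (m k)] in
theorem firstCoords_block (w : ℝ) (a : ℕ) : FirstCoords m (a + 1) (block m w a) := by
  classical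
  intro x y h
  have h1 := firstCoords_mem_interval a.le_succ (0 : VilenkinGroup m) x y h
  simp only [eq_iff_iff] at h1
  simp only [block, Set.indicator_apply, h1, firstCoords_rademacher a x y h]

omit [∀ k, NeZero (m k)] in
theorem norm_block_le {w : ℝ} (hw : 0 ≤ w) (a : ℕ) (x : VilenkinGroup m) :
    ‖block m w a x‖ ≤ w := by
  by_cases hx : x ∈ interval m a 0
  · rw [block, Set.indicator_of_mem hx, norm_mul, norm_rademacher, Complex.norm_real,
      Real.norm_of_nonneg hw, mul_one]
  · rw [block, Set.indicator_of_notMem hx, norm_zero]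
    exact hw

/-- Adding `1` to the `a`-th coordinate preserves `s` and the measure and multiplies the block by a
root of unity `ζ ≠ 1`, so the integral equals `ζ` times itself. -/
theorem setIntegral_block (hm : ∀ k, 2 ≤ m k) (w : ℝ) (a : ℕ) {s : Set (VilenkinGroup m)}
    (hs : FirstCoords m a (· ∈ s)) : ∫ x in s, block m w a x ∂(haar m) = 0 := by
  have hsm : MeasurableSet s := (filtration m).le a _ hs.measurableSet
  rw [← integral_indicator hsm]
  have hmeas : Measurable (s.indicator (block m w a)) :=
    (firstCoords_block w a).measurable.indicator hsm
  set c : VilenkinGroup m := Pi.single a 1 with hc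
  have hnear : ∀ x, x + c ∈ interval m a x := by
    intro x i hi
    simp [hc, Pi.single_eq_of_ne hi.ne]
  set ζ : ℂ := ZMod.stdAddChar (1 : ZMod (m a)) with hζ
  have hζ1 : ζ ≠ 1 := by
    intro h
    have : Fact (1 < m a) := ⟨hm a⟩
    have h1 : ZMod.stdAddChar (1 : ZMod (m a)) = ZMod.stdAddChar (0 : ZMod (m a)) := by
      rw [AddChar.map_zero_eq_one]; exact h
    exact one_ne_zero (ZMod.injective_stdAddChar h1)
  have hpt : ∀ x, s.indicator (block m w a) (x + c) = ζ * s.indicator (block m w a) x := by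
    intro x
    have h1 := hs x (x + c) (hnear x)
    have h2 := firstCoords_mem_interval le_rfl (0 : VilenkinGroup m) x (x + c) (hnear x)
    simp only [eq_iff_iff] at h1 h2
    have h3 : rademacher m a (x + c) = ζ * rademacher m a x := by
      rw [rademacher_eq_stdAddChar, rademacher_eq_stdAddChar, Pi.add_apply, AddChar.map_add_eq_mul,
        hc, Pi.single_eq_same, mul_comm]
    by_cases hxs : x ∈ s
    · rw [Set.indicator_of_mem hxs, Set.indicator_of_mem (h1.2 hxs)]
      by_cases hx : x ∈ interval m a 0
      · rw [block, block, Set.indicator_of_mem hx, Set.indicator_of_mem (h2.2 hx), h3]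
        ring
      · rw [block, block, Set.indicator_of_notMem hx, Set.indicator_of_notMem (mt h2.1 hx),
          mul_zero]
    · rw [Set.indicator_of_notMem hxs, Set.indicator_of_notMem (mt h1.1 hxs), mul_zero]
  have h := integral_add_right_haar hmeas c
  simp only [hpt] at h
  rw [integral_const_mul] at h
  have h2 : (ζ - 1) * ∫ x, s.indicator (block m w a) x ∂(haar m) = 0 := by
    rw [sub_mul, h, one_mul, sub_self]
  exact (mul_eq_zero.1 h2).resolve_left (sub_ne_zero.2 hζ1)

theorem integral_block_mul (hm : ∀ k, 2 ≤ m k) (w : ℝ) (a : ℕ) {g : VilenkinGroup m → ℂ}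
    (hg : FirstCoords m a g) : ∫ x, block m w a x * g x ∂(haar m) = 0 :=
  integral_mul_eq_zero (firstCoords_block w a).integrable hg
    fun y => setIntegral_block hm w a (firstCoords_mem_interval le_rfl y)

theorem integral_block_mul_conj_psi (hm : ∀ k, 2 ≤ m k) (w : ℝ) (a : ℕ) :
    ∫ x, block m w a x * (starRingEnd ℂ) (psi m (bigM m a) x) ∂(haar m) =
      ((w * (bigM m a : ℝ)⁻¹ : ℝ) : ℂ) := by
  have hpt : ∀ x, block m w a x * (starRingEnd ℂ) (psi m (bigM m a) x) =
      (interval m a 0).indicator (fun _ => (w : ℂ)) x := by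
    intro x
    by_cases hx : x ∈ interval m a 0
    · rw [block, Set.indicator_of_mem hx, Set.indicator_of_mem hx, psi_bigM hm, mul_assoc,
        Complex.mul_conj, Complex.normSq_eq_norm_sq, norm_rademacher]
      norm_num
    · rw [block, Set.indicator_of_notMem hx, Set.indicator_of_notMem hx, zero_mul]
  simp only [hpt]
  rw [integral_indicator_const _ (measurableSet_interval _ _), Measure.real, haar_interval]
  simp [mul_comm]

theorem lintegral_enorm_block_rpow {p : ℝ} (hp : 0 < p) {v : ℝ} (hv : 0 ≤ v) (a : ℕ) :
    ∫⁻ x, ‖block m ((v * bigM m a) ^ (1 / p)) a x‖ₑ ^ p ∂(haar m) = ENNReal.ofReal v := by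
  have hM : (0 : ℝ) ≤ bigM m a := Nat.cast_nonneg _
  have hpt : ∀ x, ‖block m ((v * bigM m a) ^ (1 / p)) a x‖ₑ ^ p =
      (interval m a 0).indicator (fun _ => ENNReal.ofReal v * bigM m a) x := by
    intro x
    by_cases hx : x ∈ interval m a 0
    · rw [block, Set.indicator_of_mem hx, Set.indicator_of_mem hx, ← ofReal_norm, norm_mul,
        norm_rademacher, mul_one, Complex.norm_real, Real.norm_of_nonneg (by positivity),
        ENNReal.ofReal_rpow_of_nonneg (by positivity) hp.le, ← Real.rpow_mul (by positivity),
        one_div_mul_cancel hp.ne', Real.rpow_one, ENNReal.ofReal_mul hv, ENNReal.ofReal_natCast]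
    · rw [block, Set.indicator_of_notMem hx, Set.indicator_of_notMem hx]
      simp [hp]
  simp only [hpt]
  rw [lintegral_indicator_const (measurableSet_interval _ _), haar_interval, mul_assoc,
    ENNReal.mul_inv_cancel (bigM_cast_ne_zero a) (bigM_cast_ne_top a), mul_one]

/-! ### Martingales built from blocks -/

/-- The martingale with blocks of heights `w k` and ranks `α k`. -/
noncomputable def lacunary (m : ℕ → ℕ) (w : ℕ → ℝ) (α : ℕ → ℕ) (n : ℕ) (x : VilenkinGroup m) :
    ℂ :=
  ∑ k ∈ Finset.range n, if α k < n then block m (w k) (α k) x else 0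

variable {w : ℕ → ℝ} {α : ℕ → ℕ}

omit [∀ k, NeZero (m k)] in
theorem firstCoords_lacunary (n : ℕ) : FirstCoords m n (lacunary m w α n) := by
  intro x y h
  refine Finset.sum_congr rfl fun k _ => ?_
  split_ifs with hk
  · exact (firstCoords_block (w k) (α k)).mono hk x y h
  · rfl

omit [∀ k, NeZero (m k)] in
theorem lacunary_succ (hα : StrictMono α) (n : ℕ) (x : VilenkinGroup m) :
    lacunary m w α (n + 1) x = lacunary m w α n x +
      ∑ k ∈ Finset.range (n + 1), if α k = n then block m (w k) (α k) x else 0 := by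
  have h : lacunary m w α n x =
      ∑ k ∈ Finset.range (n + 1), if α k < n then block m (w k) (α k) x else 0 := by
    -- As `α n ≥ n`, the index `n` adds nothing at time `n`; hence summing over `k < n` already
    -- captures every block of rank below `n`.
    rw [Finset.sum_range_succ, if_neg (not_lt.2 (hα.le_apply)), add_zero]
    rfl
  rw [h, ← Finset.sum_add_distrib]
  refine Finset.sum_congr rfl fun k _ => ?_
  by_cases h1 : α k < n
  · simp [h1, h1.ne, h1.trans n.lt_succ_self]
  · by_cases h2 : α k = n
    · simp [h2]
    · simp [h1, h2, show ¬ α k < n + 1 by omega]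

omit [∀ k, NeZero (m k)] in
theorem lacunary_apply_succ (hα : StrictMono α) (K : ℕ) (x : VilenkinGroup m) :
    lacunary m w α (α K + 1) x = lacunary m w α (α K) x + block m (w K) (α K) x := by
  rw [lacunary_succ hα, Finset.sum_eq_single_of_mem K
    (Finset.mem_range.2 (Nat.lt_succ_of_le hα.le_apply))]
  · simp
  · intro k _ hk
    rw [if_neg fun h => hk (hα.injective h)]

theorem martingale_lacunary (hm : ∀ k, 2 ≤ m k) (hα : StrictMono α) :
    Martingale (lacunary m w α) (filtration m) (haar m) := by
  refine martingale_of_setIntegral_eq_succ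
    (fun n => (firstCoords_lacunary n).measurable_filtration.stronglyMeasurable)
    (fun n => (firstCoords_lacunary n).integrable) fun n s hs => ?_
  have hs' : FirstCoords m n (· ∈ s) := by
    have : Measurable[filtration m n] (· ∈ s) := by
      intro t _
      by_cases h1 : True ∈ t <;> by_cases h2 : False ∈ t
      · convert @MeasurableSet.univ _ (filtration m n)
        ext x; by_cases hx : x ∈ s <;> simp [hx, h1, h2]
      · convert hs
        ext x; by_cases hx : x ∈ s <;> simp [hx, h1, h2]
      · convert hs.compl
        ext x; by_cases hx : x ∈ s <;> simp [hx, h1, h2]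
      · convert @MeasurableSet.empty _ (filtration m n)
        ext x; by_cases hx : x ∈ s <;> simp [hx, h1, h2]
    exact firstCoords_of_measurable this
  have hint : ∀ k, Integrable (fun x => if α k = n then block m (w k) (α k) x else 0)
      (haar m) := by
    intro k
    split_ifs
    · exact (firstCoords_block _ _).integrable
    · exact integrable_zero _ _ _
  simp only [lacunary_succ hα]
  rw [integral_add (firstCoords_lacunary n).integrable.integrableOn
    (integrable_finsetSum _ fun k _ => hint k).integrableOn,
    integral_finsetSum _ fun k _ => (hint k).integrableOn, Finset.sum_eq_zero, add_zero]
  intro k _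
  split_ifs with h
  · exact setIntegral_block hm _ _ (h ▸ hs')
  · simp

omit [∀ k, NeZero (m k)] in
theorem maximalFunction_lacunary_le (x : VilenkinGroup m) :
    maximalFunction m (lacunary m w α) x ≤ ∑' k, ‖block m (w k) (α k) x‖ₑ := by
  refine iSup_le fun n => (enorm_sum_le _ _).trans
    (le_trans (Finset.sum_le_sum fun k _ => ?_) (ENNReal.sum_le_tsum (Finset.range n)))
  split_ifs <;> simp

/-- The height `(v M_a)^{1/p}` on an interval of measure `1 / M_a` makes the `p`-th power integrate
to `v`, and for `p ≤ 1` these powers add up. -/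
theorem memHardy_lacunary (hm : ∀ k, 2 ≤ m k) (hα : StrictMono α) {p : ℝ} (hp : 0 < p)
    (hp1 : p ≤ 1) {v : ℕ → ℝ} (hv : ∀ k, 0 ≤ v k) (hsum : Summable v) :
    MemHardy m p (lacunary m (fun k => (v k * bigM m (α k)) ^ (1 / p)) α) := by
  refine ⟨martingale_lacunary hm hα, ?_⟩
  rw [hardyNorm, eLpNorm_eq_lintegral_rpow_enorm_toReal (by simpa using hp) (by simp),
    ENNReal.toReal_ofReal hp.le]
  refine ENNReal.rpow_lt_top_of_nonneg (by positivity) (ne_of_lt ?_)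
  simp only [enorm_eq_self]
  calc _ ≤ ∫⁻ x, ∑' k, ‖block m ((v k * bigM m (α k)) ^ (1 / p)) (α k) x‖ₑ ^ p ∂(haar m) := by
        refine lintegral_mono fun x => ?_
        exact (ENNReal.rpow_le_rpow (maximalFunction_lacunary_le x) hp.le).trans
          (rpow_tsum_le_tsum_rpow _ hp hp1)
    _ = ∑' k, ENNReal.ofReal (v k) := by
        rw [lintegral_tsum fun k =>
          ((firstCoords_block _ _).measurable.enorm.pow_const _).aemeasurable]
        simp only [lintegral_enorm_block_rpow hp (hv _)]
    _ < ∞ := hsum.tsum_ofReal_lt_top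

omit [∀ k, NeZero (m k)] in
theorem norm_lacunary_le (hα : StrictMono α) (hw : ∀ k, 0 ≤ w k) {A : ℝ} (K : ℕ)
    (hA : ∀ k < K, w k ≤ A) (x : VilenkinGroup m) : ‖lacunary m w α (α K) x‖ ≤ K * A := by
  rw [lacunary, ← Finset.sum_filter]
  have hsub : (Finset.range (α K)).filter (fun k => α k < α K) ⊆ Finset.range K := by
    intro k hk
    exact Finset.mem_range.2 (hα.lt_iff_lt.1 (Finset.mem_filter.1 hk).2)
  calc _ ≤ ∑ k ∈ (Finset.range (α K)).filter (fun k => α k < α K), w k :=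
        (norm_sum_le _ _).trans (Finset.sum_le_sum fun k _ => norm_block_le (hw k) _ x)
    _ ≤ ∑ k ∈ Finset.range K, w k := Finset.sum_le_sum_of_subset_of_nonneg hsub fun k _ _ => hw k
    _ ≤ ∑ k ∈ Finset.range K, A := Finset.sum_le_sum fun k hk => hA k (Finset.mem_range.1 hk)
    _ = _ := by simp

theorem sum_integral_mul_dirichlet (hm : ∀ k, 2 ≤ m k) {g : VilenkinGroup m → ℂ} {N : ℕ}
    (hg : FirstCoords m N g) (n : ℕ) (x : VilenkinGroup m) :
    ∑ k ∈ Finset.range n, ∫ t, g t * dirichlet m k x t ∂(haar m) =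
      ∫ t, g t * fejer m n x t ∂(haar m) := by
  simp only [fejer, Finset.mul_sum]
  refine (integral_finsetSum _ fun k _ => ?_).symm
  exact ((hg.mono (le_max_left N k)).comp₂ ((firstCoords_dirichlet hm (lt_bigM m hm k).le x).mono
    (le_max_right N k)) (· * ·)).integrable

/-- The index `M + 2` is the first whose mean includes `S_{M+1}`, hence `ψ_M`. The block of rank `α
K` is orthogonal to the kernels of index at most `M`, and later blocks are invisible because `M + 1
≤ M_{α K + 1}`. -/
theorem tMean_lacunary (hm : ∀ k, 2 ≤ m k) (hα : StrictMono α) (q : ℕ → ℝ) (K : ℕ)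
    (x : VilenkinGroup m) :
    tMean m q (lacunary m w α) (bigM m (α K) + 2) x =
      ((bigQ q (bigM m (α K) + 2) : ℝ) : ℂ)⁻¹ * ∑ k ∈ Finset.range (bigM m (α K) + 2),
        (q k : ℂ) * ∫ t, lacunary m w α (α K) t * dirichlet m k x t ∂(haar m) +
      ((q (bigM m (α K) + 1) / bigQ q (bigM m (α K) + 2) *
        (w K * (bigM m (α K) : ℝ)⁻¹) : ℝ) : ℂ) * psi m (bigM m (α K)) x := by
  set a := α K with ha
  set M := bigM m a with hM
  have hM1 : 1 ≤ M := bigM_pos a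
  have hM2 : M + 1 ≤ bigM m (a + 1) := by
    have : 2 * M ≤ bigM m (a + 1) := Nat.mul_le_mul_right _ (hm a)
    omega
  have hdir : ∀ k ≤ M + 1, FirstCoords m (a + 1) (dirichlet m k x) := fun k hk =>
    firstCoords_dirichlet hm (hk.trans hM2) x
  have hS : ∀ k ≤ M + 1, partialSum m (lacunary m w α) k x =
      ∫ t, lacunary m w α a t * dirichlet m k x t ∂(haar m) +
      ∫ t, block m (w K) a t * dirichlet m k x t ∂(haar m) := by
    intro k hk
    rw [partialSum_eq_integral hm (martingale_lacunary hm hα) (hk.trans hM2),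
      ← integral_add (((firstCoords_lacunary a).mono a.le_succ).comp₂ (hdir k hk)
        (· * ·)).integrable ((firstCoords_block (w K) a).comp₂ (hdir k hk) (· * ·)).integrable]
    congr 1
    funext t
    rw [ha, lacunary_apply_succ hα, add_mul]
  have hB0 : ∀ k ≤ M, ∫ t, block m (w K) a t * dirichlet m k x t ∂(haar m) = 0 := fun k hk =>
    integral_block_mul hm _ _ (firstCoords_dirichlet hm hk x)
  have hB1 : ∫ t, block m (w K) a t * dirichlet m (M + 1) x t ∂(haar m) =
      ((w K * (M : ℝ)⁻¹ : ℝ) : ℂ) * psi m M x := by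
    have e : ∀ t, block m (w K) a t * dirichlet m (M + 1) x t =
        block m (w K) a t * dirichlet m M x t +
        psi m M x * (block m (w K) a t * (starRingEnd ℂ) (psi m M t)) := by
      intro t
      rw [dirichlet, Finset.sum_range_succ, psiTwo, dirichlet]
      ring
    simp only [e]
    rw [integral_add ((firstCoords_block (w K) a).comp₂ (hdir M M.le_succ) (· * ·)).integrable
      ((((firstCoords_block (w K) a).comp₂ ((firstCoords_psi hm
        (lt_of_lt_of_le M.lt_succ_self hM2)).comp (starRingEnd ℂ)) (· * ·)).integrable).const_mul _),
      hB0 M le_rfl, integral_const_mul, integral_block_mul_conj_psi hm, zero_add, mul_comm]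
  have hsum : ∑ k ∈ Finset.range (M + 2), (q k : ℂ) * partialSum m (lacunary m w α) k x =
      ∑ k ∈ Finset.range (M + 2),
        (q k : ℂ) * ∫ t, lacunary m w α a t * dirichlet m k x t ∂(haar m) +
      q (M + 1) * (((w K * (M : ℝ)⁻¹ : ℝ) : ℂ) * psi m M x) := by
    rw [Finset.sum_congr rfl fun k hk => by
      rw [hS k (Nat.lt_succ_iff.1 (Finset.mem_range.1 hk)), mul_add]]
    rw [Finset.sum_add_distrib]
    congr 1
    rw [Finset.sum_range_succ, hB1, Finset.sum_eq_zero, zero_add]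
    intro k hk
    rw [hB0 k (Nat.lt_succ_iff.1 (Finset.mem_range.1 hk)), mul_zero]
  rw [tMean, hsum]
  push_cast
  ring

/-- Reverse triangle inequality. The earlier blocks form a function bounded by `K A`, whose means
are controlled by the Fejér bound and Abel summation as in a); the new term has constant modulus
because `|ψ_M| = 1`. -/
theorem le_norm_tMean_lacunary (hm : ∀ k, 2 ≤ m k) {b : ℕ} (hb : ∀ k, m k ≤ b)
    {q : ℕ → ℝ} (hq_nonneg : ∀ k, 0 ≤ q k) (hq_zero : 0 < q 0) (hq_anti : Antitone q)
    {c : ℝ} (hc : ∀ n : ℕ, 1 ≤ n → c / (n : ℝ) ≤ q (n + 1) / bigQ q (n + 2))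
    (hα : StrictMono α) (hw : ∀ k, 0 ≤ w k) {A : ℝ} (hA0 : 0 ≤ A) (K : ℕ)
    (hA : ∀ k < K, w k ≤ A) (x : VilenkinGroup m) :
    c * w K * ((bigM m (α K) : ℝ)⁻¹) ^ 2 - 12 * b ^ 3 * (K * A) ≤
      ‖tMean m q (lacunary m w α) (bigM m (α K) + 2) x‖ := by
  rw [tMean_lacunary hm hα]
  set M := bigM m (α K) with hM
  have hM1 : 1 ≤ M := bigM_pos _
  lift A to ℝ≥0 using hA0
  have h1 : ‖((bigQ q (M + 2) : ℝ) : ℂ)⁻¹ * ∑ k ∈ Finset.range (M + 2),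
      (q k : ℂ) * ∫ t, lacunary m w α (α K) t * dirichlet m k x t ∂(haar m)‖ ≤
      12 * b ^ 3 * (K * A) := by
    have h := enorm_mean_le hq_nonneg hq_zero hq_anti
      (s := fun k => ∫ t, lacunary m w α (α K) t * dirichlet m k x t ∂(haar m))
      (Z := 12 * b ^ 3 * ((K * A : ℝ≥0) : ℝ≥0∞)) (M + 2) fun j => by
        rw [sum_integral_mul_dirichlet hm (firstCoords_lacunary _)]
        refine enorm_integral_mul_fejer_le hm hb (fun t => ?_) j x
        rw [enorm_le_coe, ← NNReal.coe_le_coe, coe_nnnorm]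
        push_cast
        exact norm_lacunary_le hα hw K hA t
    have e : 12 * (b : ℝ≥0∞) ^ 3 * ((K * A : ℝ≥0) : ℝ≥0∞) = ((12 * b ^ 3 * (K * A) : ℝ≥0) : ℝ≥0∞) := by
      push_cast; ring
    rw [e, enorm_le_coe, ← NNReal.coe_le_coe, coe_nnnorm] at h
    push_cast at h
    exact h
  have h2 : c * w K * ((M : ℝ)⁻¹) ^ 2 ≤
      ‖((q (M + 1) / bigQ q (M + 2) * (w K * (M : ℝ)⁻¹) : ℝ) : ℂ) * psi m M x‖ := by
    rw [norm_mul, norm_psi, mul_one, Complex.norm_real]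
    refine le_trans ?_ (le_abs_self _)
    have h0 : 0 ≤ w K * (M : ℝ)⁻¹ := mul_nonneg (hw K) (by positivity)
    calc c * w K * ((M : ℝ)⁻¹) ^ 2 = c / M * (w K * (M : ℝ)⁻¹) := by ring
      _ ≤ _ := mul_le_mul_of_nonneg_right (hc M hM1) h0
  have h3 := norm_sub_le_norm_add
    (((q (M + 1) / bigQ q (M + 2) * (w K * (M : ℝ)⁻¹) : ℝ) : ℂ) * psi m M x)
    (((bigQ q (M + 2) : ℝ) : ℂ)⁻¹ * ∑ k ∈ Finset.range (M + 2),
      (q k : ℂ) * ∫ t, lacunary m w α (α K) t * dirichlet m k x t ∂(haar m))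
  rw [add_comm (_ * _ : ℂ) (_ * _)] at h3
  linarith

omit [∀ k, NeZero (m k)] in
theorem tendsto_bigM (hm : ∀ k, 2 ≤ m k) : Tendsto (fun a => (bigM m a : ℝ)) atTop atTop :=
  tendsto_natCast_atTop_atTop.comp
    (tendsto_atTop_mono (fun a => (lt_bigM m hm a).le) tendsto_id)

/-- The heights of the blocks in the counterexample. -/
noncomputable def height (m : ℕ → ℕ) (p : ℝ) (k a : ℕ) : ℝ := ((1 / 2) ^ k * bigM m a) ^ (1 / p)

omit [∀ k, NeZero (m k)] in
theorem height_nonneg (p : ℝ) (k a : ℕ) : 0 ≤ height m p k a := by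
  unfold height; positivity

/-- For fixed `k` the right side is a positive multiple of `M_{a'}^{1/p - 2}`, and the exponent is
positive precisely when `p < 1/2`. -/
theorem exists_rank (hm : ∀ k, 2 ≤ m k) {p c : ℝ} (hp : 0 < p) (hp2 : p < 1 / 2) (hc : 0 < c)
    (R : ℝ) (k a : ℕ) :
    ∃ a' > a, R ≤ c * height m p k a' * ((bigM m a' : ℝ)⁻¹) ^ 2 := by
  have hexp : 0 < 1 / p - 2 := by
    rw [sub_pos, lt_div_iff₀ hp]
    linarith
  have hκ : 0 < c * ((1 / 2 : ℝ) ^ k) ^ (1 / p) := by positivity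
  have ht := ((tendsto_rpow_atTop hexp).comp (tendsto_bigM hm)).const_mul_atTop hκ
  obtain ⟨a', ha', h⟩ := ((eventually_gt_atTop a).and (ht.eventually_ge_atTop R)).exists
  refine ⟨a', ha', h.trans (le_of_eq ?_)⟩
  have hM : (0 : ℝ) < bigM m a' := by exact_mod_cast bigM_pos a'
  simp only [Function.comp, height]
  rw [Real.mul_rpow (by positivity) hM.le, Real.rpow_sub hM, Real.rpow_two]
  field_simp

/-- A lacunary martingale in `H_p` whose means are unbounded. -/
theorem exists_memHardy_iSup_eq_top (hm : ∀ k, 2 ≤ m k) {b : ℕ} (hb : ∀ k, m k ≤ b)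
    {q : ℕ → ℝ} (hq_nonneg : ∀ k, 0 ≤ q k) (hq_zero : 0 < q 0) (hq_anti : Antitone q)
    {p c : ℝ} (hp : 0 < p) (hp2 : p < 1 / 2) (hc0 : 0 < c)
    (hc : ∀ n : ℕ, 1 ≤ n → c / (n : ℝ) ≤ q (n + 1) / bigQ q (n + 2)) :
    ∃ f : ℕ → VilenkinGroup m → ℂ, MemHardy m p f ∧
      ⨆ n : ℕ, weakNorm (haar m) p (tMean m q f n) = ∞ := by
  choose next hnext1 hnext2 using fun (R : ℝ) (k a : ℕ) => exists_rank hm hp hp2 hc0 R k a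
  -- This bounds the contribution of the first `K + 1` blocks when `a = α K`; the next rank is
  -- chosen to exceed it by `K + 1`.
  set bound : ℕ → ℕ → ℝ := fun K a => 12 * b ^ 3 * ((K + 1 : ℕ) * (bigM m a : ℝ) ^ (1 / p)) with hbd
  let α : ℕ → ℕ := fun K => K.rec 0 fun K a => next (bound K a + (K + 1)) (K + 1) a
  have hαs : ∀ K, α (K + 1) = next (bound K (α K) + (K + 1)) (K + 1) (α K) := fun _ => rfl
  have hα : StrictMono α := strictMono_nat_of_lt_succ fun K => by rw [hαs]; exact hnext1 _ _ _
  set w : ℕ → ℝ := fun k => height m p k (α k) with hw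
  have hwA : ∀ K, ∀ k < K + 1, w k ≤ (bigM m (α K) : ℝ) ^ (1 / p) := by
    intro K k hk
    refine Real.rpow_le_rpow (by positivity) ?_ (by positivity)
    calc (1 / 2 : ℝ) ^ k * bigM m (α k) ≤ 1 * bigM m (α K) := by
          gcongr
          · exact pow_le_one₀ (by norm_num) (by norm_num)
          · exact bigM_mono (hα.monotone (Nat.lt_succ_iff.1 hk))
      _ = _ := one_mul _
  refine ⟨lacunary m w α, ?_, ?_⟩
  · exact memHardy_lacunary hm hα hp (by linarith) (v := fun k => (1 / 2 : ℝ) ^ k)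
      (fun k => by positivity) summable_geometric_two
  · refine ENNReal.eq_top_of_forall_nnreal_le fun r => ?_
    obtain ⟨K, hK⟩ := exists_nat_gt r
    rcases eq_or_ne r 0 with rfl | hr
    · simp
    have hlow : ∀ x, (K + 1 : ℝ) ≤
        ‖tMean m q (lacunary m w α) (bigM m (α (K + 1)) + 2) x‖ := by
      intro x
      refine le_trans ?_ (le_norm_tMean_lacunary hm hb hq_nonneg hq_zero hq_anti hc hα
        (fun k => height_nonneg p k _) (A := (bigM m (α K) : ℝ) ^ (1 / p)) (by positivity) (K + 1)
        (hwA K) x)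
      have := hnext2 (bound K (α K) + (K + 1)) (K + 1) (α K)
      rw [← hαs] at this
      simp only [hbd] at this
      linarith
    refine le_trans ?_ (le_iSup _ (bigM m (α (K + 1)) + 2))
    refine le_trans ?_ (le_iSup₂ (f := fun (t : ℝ≥0) (_ : 0 < t) => (t : ℝ≥0∞) * _ ^ (1 / p))
      r (pos_iff_ne_zero.2 hr))
    -- The lower bound holds at every point, so the level set is the whole group and the exponent `1
    -- / p` costs nothing.
    have huniv : {x | (r : ℝ≥0∞) <
        ‖tMean m q (lacunary m w α) (bigM m (α (K + 1)) + 2) x‖ₑ} = Set.univ := by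
      refine Set.eq_univ_of_forall fun x => ?_
      simp only [Set.mem_ofPred_eq]
      rw [← not_le, enorm_le_coe, not_le, ← NNReal.coe_lt_coe, coe_nnnorm]
      have : (r : ℝ) < K := by exact_mod_cast hK
      linarith [hlow x]
    rw [huniv, measure_univ]
    simp

end Vilenkin

theorem mainTheorem3 (m : ℕ → ℕ) (hm : ∀ k, 2 ≤ m k) (hbdd : BddAbove (Set.range m))
    (q : ℕ → ℝ) (hq_nonneg : ∀ k, 0 ≤ q k) (hq_zero : 0 < q 0) (hq_anti : Antitone q) :
    (∃ C : ℝ≥0, ∀ f : ℕ → VilenkinGroup m → ℂ, Vilenkin.MemHardy m (1 / 2) f →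
      Measurable (Vilenkin.tMaximal m q f) ∧
      Vilenkin.weakNorm (Vilenkin.haar m) (1 / 2) (Vilenkin.tMaximal m q f) ≤
        C * Vilenkin.hardyNorm m (1 / 2) f) ∧
    (∀ p : ℝ, 0 < p → p < 1 / 2 →
      (∃ c : ℝ, 0 < c ∧ ∀ n : ℕ, 1 ≤ n →
        c / (n : ℝ) ≤ q (n + 1) / Vilenkin.bigQ q (n + 2)) →
      ∃ f : ℕ → VilenkinGroup m → ℂ, Vilenkin.MemHardy m p f ∧
        ⨆ n : ℕ, Vilenkin.weakNorm (Vilenkin.haar m) p (Vilenkin.tMean m q f n) = ∞) := by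
  have : ∀ k, NeZero (m k) := fun k => ⟨by have := hm k; omega⟩
  obtain ⟨b, hb'⟩ := hbdd
  have hb : ∀ k, m k ≤ b := fun k => hb' ⟨k, rfl⟩
  refine ⟨⟨(Vilenkin.weakConst b ^ 2).toNNReal, fun f hf =>
    ⟨Vilenkin.measurable_tMaximal q f, ?_⟩⟩, ?_⟩
  · rw [ENNReal.coe_toNNReal (ENNReal.pow_ne_top (Vilenkin.weakConst_ne_top b))]
    exact Vilenkin.weakNorm_tMaximal_le hm hb hq_nonneg hq_zero hq_anti hf.1
  · rintro p hp hp2 ⟨c, hc0, hc⟩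
    exact Vilenkin.exists_memHardy_iSup_eq_top hm hb hq_nonneg hq_zero hq_anti hp hp2 hc0 hc
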